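/- Let $G$ be a real Lie group of dimension $n$ with Lie algebra $\mathfrak g$, and let $\mathbf F\in\mathbf Z^2(\mathfrak g;\mathbb R)$ be a 2-cocycle. For $X\in\mathfrak g$ put $\xi_X=(L_g)_*X$ and $\eta_X=-(R_g)_*X$, and let $\mathrm F(\zeta_1,\zeta_2)=\mathbf F((R_{g^{-1}})_*\zeta_1,(R_{g^{-1}})_*\zeta_2)$ be the corresponding right-invariant 2-form. Let $\widetilde{\mathfrak g}=\mathfrak g\oplus\mathbb RZ$ with $Z$ central and $[X,Y]_{\mathbf F}=[X,Y]+\mathbf F(X,Y)Z$. Let $\widetilde G$ be a Lie group with Lie algebra $\widetilde{\mathfrak g}$, $\pi:\widetilde G\to G$ a smooth surjective homomorphism with differential $X+cZ\mapsto X$, and $T=\{\exp(tZ):t\in\mathbb R\}\subset\ker\pi$ a closed central subgroup isomorphic to $\mathbb R$ via $t\mapsto \exp(tZ)$. (If $\ker\pi=T$, then $\widetilde G$ is a central extension of $G$ by $T$; in general it is one locally.) Let $\widetilde\xi_X,\widetilde\eta_X$ be the fields on $\widetilde G$ defined in the same way from $X\in\mathfrak g\subset\widetilde{\mathfrak g}$.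 For a smooth local section $s:V\to\widetilde G$ of $\pi$ over an open set $V\subset G$, let $g^0$ be the fibre coordinate, $g^0(s(g)\exp(tZ))=t$, and let $U=e^{-g^0}$, i.e. the representation $U(t)=e^{-t}$ of $T$ regarded as a function on $s(V)T$. Then every point of $G$ lies in the domain $V$ of a smooth local section, and for every smooth local section $s:V\to\widetilde G$: 1. $U$ is smooth on $s(V)T$; for $g\in V$ the number $$\mathbf f(Y)(g)=U^{-1}\bigl(\widetilde\xi_Y+\widetilde\eta_{\mathrm{Ad}_gY}\bigr)U$$ is the same at all points $s(g)t$, $t\in T$, and it defines a 1-cochain $\mathbf f$: it is linear in $Y\in\mathfrak g$ and smooth in $g\in V$. 2. For all $X,Y\in\mathfrak g$, $\ \eta_X\mathbf f(Y)+\mathrm F(\eta_X,\xi_Y)=0$ on $V$. 3. Let $\mathbf G$ be a nondegenerate symmetric bilinear form on $\mathfrak g$, let $g_{ij}$ be the components of the right-invariant pseudo-Riemannian metric it defines, let $H(g,p)=\tfrac12 g^{ij}(g)p_ip_j$ on $T^*G$, and let $\mathrm e\in\mathbb R$. For every $X\in\mathfrak g$ the function $\xi_X(g,p)+\mathrm e\,\mathbf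 f(X)(g)$, with $\xi_X(g,p)=p(\xi_X)$, is an integral of motion over $V$ of the magnetic geodesic flow $$\dot g^i=\frac{\partial H}{\partial p_i},\qquad \dot p_i=-\frac{\partial H}{\partial g^i}-\mathrm e\,\mathrm F_{ij}\frac{\partial H}{\partial p_j}.$$ That is, it is smooth on $T^*V$, it is constant along every trajectory that stays over $V$, and it commutes with $H$ for the Poisson bracket determined by $\{g^i,g^j\}=0$, $\{p_i,g^j\}=\delta_i^j$, $\{p_i,p_j\}=\mathrm e\,\mathrm F_{ij}$. 4. For every basis $e_1,\dots,e_n$ of $\mathfrak g$, writing $\mathrm{Ad}_ge_a=(\mathrm{Ad}_g)_a^b\,e_b$ and denoting by $\widetilde\xi_a^{\,0},\widetilde\eta_a^{\,0}$ the $\partial/\partial g^0$-components of $\widetilde\xi_{e_a},\widetilde\eta_{e_a}$, one has on $V$ $$\mathbf f_a=\mathbf f(e_a)=-\widetilde\xi_a^{\,0}-(\mathrm{Ad}_g)_a^b\,\widetilde\eta_b^{\,0}.$$ If moreover $\ker\pi=T$, then there is a global 1-cochain $\mathbf f\in\mathbf C^1(\mathfrak g;C^\infty(G))$ that agrees over every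 $V$ with the cochain of 1 for every smooth local section over $V$. It satisfies $\eta_X\mathbf f(Y)+\mathrm F(\eta_X,\xi_Y)=0$ on $G$, and for all $\mathbf G$ and $\mathrm e$ as in 3 the functions $\xi_X(g,p)+\mathrm e\,\mathbf f(X)(g)$ are integrals of motion of the magnetic geodesic flow on the whole of $T^*G$. -/

import Mathlib

open scoped Manifold ContDiff

noncomputable section

namespace MagneticFlow

/-- The model space `ℝⁿ`; the coordinates of `x` are `x i`, for `i : Fin n`. -/
abbrev Model (n : ℕ) : Type := EuclideanSpace ℝ (Fin n)

/-- The `i`-th standard basis vector of `ℝⁿ`. -/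
def stdVec {n : ℕ} (i : Fin n) : Model n := EuclideanSpace.single i 1

section InvariantFields

variable {n : ℕ} {G : Type*} [TopologicalSpace G] [ChartedSpace (Model n) G] [Group G]

variable (n G) in
/-- The Lie algebra `𝔤` of `G`: the tangent space at the identity, with the bracket coming from
left-invariant vector fields. -/
abbrev LieAlg : Type := GroupLieAlgebra 𝓘(ℝ, Model n) G

/-- The left-invariant vector field `ξ_X = (L_g)_* X`. -/
def xi (X : LieAlg n G) (g : G) : TangentSpace 𝓘(ℝ, Model n) g :=
  mulInvariantVectorField X g

/-- The right-invariant vector field `η_X = -(R_g)_* X` (with the minus sign). -/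
def eta (X : LieAlg n G) (g : G) : TangentSpace 𝓘(ℝ, Model n) g :=
  -(mfderiv 𝓘(ℝ, Model n) 𝓘(ℝ, Model n) (fun h : G => h * g) 1 X)

/-- The adjoint representation: `Ad_g` is the differential at `1` of `h ↦ g h g⁻¹`. -/
def Ad (g : G) : LieAlg n G →L[ℝ] LieAlg n G :=
  mfderiv 𝓘(ℝ, Model n) 𝓘(ℝ, Model n) (fun h : G => g * h * g⁻¹) 1

/-- The map `(R_{g⁻¹})_* : T_g G → 𝔤`. -/
def toIdentity (g : G) : TangentSpace 𝓘(ℝ, Model n) g →L[ℝ] LieAlg n G :=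
  mfderiv 𝓘(ℝ, Model n) 𝓘(ℝ, Model n) (fun h : G => h * g⁻¹) g

/-- The right-invariant bilinear form on `G` whose value at the identity is `B`:
`(ζ₁, ζ₂) ↦ B ((R_{g⁻¹})_* ζ₁, (R_{g⁻¹})_* ζ₂)`. It is used for the metric and for the 2-form of
the electromagnetic field. -/
def invariantForm (B : LinearMap.BilinForm ℝ (LieAlg n G)) (g : G)
    (ζ₁ ζ₂ : TangentSpace 𝓘(ℝ, Model n) g) : ℝ :=
  B (toIdentity g ζ₁) (toIdentity g ζ₂)

/-- The derivative `v φ` of a real function `φ` along the tangent vector `v` at `g`. -/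
def dirDeriv (φ : G → ℝ) (g : G) (v : TangentSpace 𝓘(ℝ, Model n) g) : ℝ :=
  mfderiv 𝓘(ℝ, Model n) 𝓘(ℝ, ℝ) φ g v

end InvariantFields

section Flow

variable {n : ℕ} {G : Type*} [TopologicalSpace G] [ChartedSpace (Model n) G]

variable (n G) in
/-- The cotangent bundle `T*G`; a point is `⟨g, p⟩` with `p` a linear form on `T_g G`. -/
abbrev Cotangent : Type _ :=
  Bundle.TotalSpace (Model n →L[ℝ] ℝ)
    (fun g : G => TangentSpace 𝓘(ℝ, Model n) g →L[ℝ] Bundle.Trivial G ℝ g)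

/-- The coordinate vector `∂/∂gⁱ` of the chart `c` at the point with coordinates `x`. -/
def coordVec (c : OpenPartialHomeomorph G (Model n)) (x : Model n) (i : Fin n) :
    TangentSpace 𝓘(ℝ, Model n) (c.symm x) :=
  mfderiv 𝓘(ℝ, Model n) 𝓘(ℝ, Model n) c.symm x (stdVec i)

/-- The coordinate `p_i = p(∂/∂gⁱ)` of a cotangent vector, with respect to the chart `c`. -/
def momentum (c : OpenPartialHomeomorph G (Model n)) (P : Cotangent n G) (i : Fin n) : ℝ :=
  P.snd (coordVec c (c P.proj) i)

/-- The cotangent vector `∑ i, p_i dgⁱ` at the point with coordinates `x` in the chart `c`. -/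
def covector (c : OpenPartialHomeomorph G (Model n)) (x p : Model n) : Cotangent n G :=
  ⟨c.symm x, (∑ i, p i • (EuclideanSpace.proj i : Model n →L[ℝ] ℝ)).comp
    (mfderiv 𝓘(ℝ, Model n) 𝓘(ℝ, Model n) c (c.symm x))⟩

/-- The expression of a function on `T*G` in the coordinates `(gⁱ, p_i)` of the chart `c`. -/
def localExpr (Φ : Cotangent n G → ℝ) (c : OpenPartialHomeomorph G (Model n))
    (x p : Model n) : ℝ :=
  Φ (covector c x p)

/-- `∂φ/∂gⁱ` for a function `φ` of the coordinates `(g, p)`. -/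
def partialG (φ : Model n → Model n → ℝ) (x p : Model n) (i : Fin n) : ℝ :=
  fderiv ℝ (fun y => φ y p) x (stdVec i)

/-- `∂φ/∂p_i` for a function `φ` of the coordinates `(g, p)`. -/
def partialP (φ : Model n → Model n → ℝ) (x p : Model n) (i : Fin n) : ℝ :=
  fderiv ℝ (fun q => φ x q) p (stdVec i)

variable [Group G]

/-- The components, in the chart `c`, of the right-invariant form with value `B` at the identity. -/
def components (B : LinearMap.BilinForm ℝ (LieAlg n G)) (c : OpenPartialHomeomorph G (Model n))
    (x : Model n) : Matrix (Fin n) (Fin n) ℝ :=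
  Matrix.of fun i j => invariantForm B (c.symm x) (coordVec c x i) (coordVec c x j)

/-- The Hamiltonian `H = ½ g^{ij}(g) p_i p_j` in the coordinates of the chart `c`, where `g^{ij}`
is the inverse of the matrix of the right-invariant metric with value `Q` at the identity. -/
def hamiltonian (Q : LinearMap.BilinForm ℝ (LieAlg n G)) (c : OpenPartialHomeomorph G (Model n))
    (x p : Model n) : ℝ :=
  (1 / 2 : ℝ) * ∑ i, ∑ j, ((components Q c x)⁻¹) i j * p i * p j

/-- The Poisson bracket on `T*G` in the coordinates of the chart `c`, determined by the basis
brackets `{gⁱ, gʲ} = 0`, `{p_i, gʲ} = δ_i^j`, `{p_i, p_j} = e F_{ij}(g)`. -/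
def poissonBracket (F : LinearMap.BilinForm ℝ (LieAlg n G)) (e : ℝ)
    (c : OpenPartialHomeomorph G (Model n)) (φ ψ : Model n → Model n → ℝ) (x p : Model n) : ℝ :=
  ∑ i, (partialP φ x p i * partialG ψ x p i - partialG φ x p i * partialP ψ x p i)
    + e * ∑ i, ∑ j, components F c x i j * partialP φ x p i * partialP ψ x p j

/-- `γ` is, on the set of times `J`, a trajectory of the magnetic geodesic flow: in all charts
`ġⁱ = ∂H/∂p_i` and `ṗ_i = -∂H/∂gⁱ - e F_{ij} ∂H/∂p_j`. -/
structure IsMagneticGeodesic (Q F : LinearMap.BilinForm ℝ (LieAlg n G)) (e : ℝ)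
    (γ : ℝ → Cotangent n G) (J : Set ℝ) : Prop where
  continuousOn : ContinuousOn (fun t => (γ t).proj) J
  position : ∀ c ∈ atlas (Model n) G, ∀ t ∈ J, (γ t).proj ∈ c.source → ∀ i : Fin n,
    HasDerivAt (fun s => c (γ s).proj i)
      (partialP (hamiltonian Q c) (c (γ t).proj) (WithLp.toLp 2 (momentum c (γ t))) i) t
  momentum : ∀ c ∈ atlas (Model n) G, ∀ t ∈ J, (γ t).proj ∈ c.source → ∀ i : Fin n,
    HasDerivAt (fun s => MagneticFlow.momentum c (γ s) i)
      (-partialG (hamiltonian Q c) (c (γ t).proj)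
          (WithLp.toLp 2 (MagneticFlow.momentum c (γ t))) i
        - e * ∑ j, components F c (c (γ t).proj) i j *
          partialP (hamiltonian Q c) (c (γ t).proj)
            (WithLp.toLp 2 (MagneticFlow.momentum c (γ t))) j) t

/-- `Φ` is an integral of motion of the magnetic geodesic flow on the part of `T*G` lying over `V`:
it is smooth there, it commutes with the Hamiltonian, and it is constant along every trajectory
over `V` (defined on an open interval of times). -/
structure IsIntegralOfMotionOn [IsManifold 𝓘(ℝ, Model n) ∞ G]
    (Q F : LinearMap.BilinForm ℝ (LieAlg n G)) (e : ℝ)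
    (V : Set G) (Φ : Cotangent n G → ℝ) : Prop where
  smooth : ContMDiffOn (𝓘(ℝ, Model n).prod 𝓘(ℝ, Model n →L[ℝ] ℝ)) 𝓘(ℝ, ℝ) ∞ Φ
    {P : Cotangent n G | P.proj ∈ V}
  bracket_eq_zero : ∀ c ∈ atlas (Model n) G, ∀ x ∈ c.target, c.symm x ∈ V → ∀ p : Model n,
    poissonBracket F e c (localExpr Φ c) (hamiltonian Q c) x p = 0
  constant : ∀ (γ : ℝ → Cotangent n G) (J : Set ℝ), IsOpen J → IsPreconnected J →
    IsMagneticGeodesic Q F e γ J → (∀ t ∈ J, (γ t).proj ∈ V) →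
    ∀ t₁ ∈ J, ∀ t₂ ∈ J, Φ (γ t₁) = Φ (γ t₂)

end Flow

section Extension

/-- A smooth Lie group has the smoothness that its Lie algebra structure needs. -/
instance instLieGroupMinSmoothness {n : ℕ} {G : Type*} [TopologicalSpace G]
    [ChartedSpace (Model n) G] [Group G] [LieGroup 𝓘(ℝ, Model n) ∞ G] :
    LieGroup 𝓘(ℝ, Model n) (minSmoothness ℝ 3) G :=
  LieGroup.of_le (n := ∞) (by
    rw [minSmoothness_of_isRCLikeNormedField]
    exact WithTop.coe_le_coe.mpr (le_top : (3 : ℕ∞) ≤ ⊤))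

variable {n : ℕ} {G : Type*} [TopologicalSpace G] [ChartedSpace (Model n) G] [Group G]
  [LieGroup 𝓘(ℝ, Model n) (minSmoothness ℝ 3) G]

variable (n G) in
/-- The space `Z²(𝔤; ℝ)` of real 2-cocycles of `𝔤` with values in the trivial module `ℝ`. -/
abbrev Cocycle : Type :=
  LieModule.Cohomology.twoCocycle ℝ (LieAlg n G) (TrivialLieModule ℝ (LieAlg n G) ℝ)

/-- The bilinear form underlying a real 2-cocycle. -/
def Cocycle.form (F : Cocycle n G) : LinearMap.BilinForm ℝ (LieAlg n G) :=
  F.1.1.compr₂ (TrivialLieModule.equiv ℝ (LieAlg n G) ℝ).toLinearMap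

/-- The element `X + c Z` of the Lie algebra `𝔤 ⊕ ℝ Z` with bracket
`[X + aZ, Y + bZ] = [X, Y] + F(X, Y) Z`. -/
def Cocycle.mk (F : Cocycle n G) (X : LieAlg n G) (c : ℝ) : LieAlgebra.ofTwoCocycle F :=
  LieAlgebra.ofProd F (X, (TrivialLieModule.equiv ℝ (LieAlg n G) ℝ).symm c)

variable (Gt : Type*) [TopologicalSpace Gt] [ChartedSpace (Model (n + 1)) Gt] [Group Gt]
  [LieGroup 𝓘(ℝ, Model (n + 1)) (minSmoothness ℝ 3) Gt]

/-- A Lie group `Gt` with Lie algebra `𝔤 ⊕ ℝ Z` (bracket twisted by `F`), together with a smooth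
surjective homomorphism `proj : Gt → G` inducing `X + cZ ↦ X`, and with the closed central
one-parameter subgroup `T = {fib t} = {exp (t Z)}`, isomorphic to `ℝ` and contained in `ker proj`.
When `ker proj = T` this is a central extension of `G` by `T`; in general it is one locally (`T` is
the identity component of `ker proj`, so that `Gt / T` is locally isomorphic to `G`). -/
structure CentralExtension (F : Cocycle n G) where
  proj : Gt →* G
  contMDiff_proj : ContMDiff 𝓘(ℝ, Model (n + 1)) 𝓘(ℝ, Model n) ∞ proj
  surjective_proj : Function.Surjective proj
  fib : ℝ → Gt
  contMDiff_fib : ContMDiff 𝓘(ℝ, ℝ) 𝓘(ℝ, Model (n + 1)) ∞ fib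
  fib_zero : fib 0 = 1
  fib_add : ∀ a b : ℝ, fib (a + b) = fib a * fib b
  injective_fib : Function.Injective fib
  isClosed_fib : IsClosed (Set.range fib)
  central_fib : ∀ (t : ℝ) (x : Gt), fib t * x = x * fib t
  proj_fib : ∀ t : ℝ, proj (fib t) = 1
  lieEquiv : LieAlgebra.ofTwoCocycle F ≃ₗ⁅ℝ⁆ LieAlg (n + 1) Gt
  mfderiv_proj : ∀ (X : LieAlg n G) (c : ℝ),
    (mfderiv 𝓘(ℝ, Model (n + 1)) 𝓘(ℝ, Model n) proj 1 (lieEquiv (F.mk X c)) : Model n) = X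
  mfderiv_fib : (mfderiv 𝓘(ℝ, ℝ) 𝓘(ℝ, Model (n + 1)) fib 0 (1 : ℝ) : Model (n + 1))
    = lieEquiv (F.mk 0 1)

namespace CentralExtension

variable {Gt} {F : Cocycle n G} (A : CentralExtension Gt F)

/-- The left-invariant vector field on `Gt` in the direction of `X ∈ 𝔤 ⊂ 𝔤 ⊕ ℝ Z`. -/
def xiT (X : LieAlg n G) (x : Gt) : TangentSpace 𝓘(ℝ, Model (n + 1)) x :=
  xi (A.lieEquiv (F.mk X 0)) x

/-- The right-invariant vector field on `Gt` in the direction of `X ∈ 𝔤 ⊂ 𝔤 ⊕ ℝ Z`. -/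
def etaT (X : LieAlg n G) (x : Gt) : TangentSpace 𝓘(ℝ, Model (n + 1)) x :=
  eta (A.lieEquiv (F.mk X 0)) x

/-- `s` is a smooth local section of `proj` over the open set `V`. -/
structure IsSection (V : Set G) (s : G → Gt) : Prop where
  isOpen : IsOpen V
  contMDiffOn : ContMDiffOn 𝓘(ℝ, Model n) 𝓘(ℝ, Model (n + 1)) ∞ s V
  proj_apply : ∀ g ∈ V, A.proj (s g) = g

/-- The fibre coordinate `g⁰` defined by a local section `s`: the coordinate of `s(g) exp(t Z)`
is `t`. -/
def fibreCoord (s : G → Gt) (x : Gt) : ℝ :=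
  Function.invFun A.fib ((s (A.proj x))⁻¹ * x)

/-- The representation `U(t) = exp(-t)` of `T`, as the function `s(g) t ↦ U(t)` on `Gt`. -/
def U (s : G → Gt) (x : Gt) : ℝ := Real.exp (-A.fibreCoord s x)

/-- The number `U⁻¹ (ξ̃_Y + η̃_{Ad_g Y}) U` at the point `x` of `Gt`, with `g = proj x`. -/
def cochainAt (s : G → Gt) (Y : LieAlg n G) (x : Gt) : ℝ :=
  (A.U s x)⁻¹ * dirDeriv (A.U s) x (A.xiT Y x + A.etaT (Ad (A.proj x) Y) x)

/-- The cochain `f(Y) = U⁻¹ (ξ̃_Y + η̃_{Ad_g Y}) U |_G`. -/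
def cochain (s : G → Gt) (Y : LieAlg n G) (g : G) : ℝ := A.cochainAt s Y (s g)

end CentralExtension

end Extension

end MagneticFlow

end

/-! Everything reduces to one function on the extension: `adCoord Y x`, minus the `Z`-component of
`Ad_x Y`. Written in right translation, `ξ̃_Y` at `x` is `Ad_x Y`, and `η̃_{Ad_g Y}` removes its
component in `𝔤`. What remains is `-adCoord Y x` times the field of `Z`, which shifts the fibre
coordinate at unit speed. Since `U = e^{-g⁰}`, the two signs cancel and the cochain at `g` is
`adCoord Y (s g)` (`xi_add_eta`, `IsSection.cochainAt_eq`). As `T` is central, `Ad` does not change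
along `T`, so the value depends only on the point of `s(V)`. If `ker π = T`, it depends only on `g`,
which gives the global cochain.

For the cochain equation, `adCoord` is differentiated along a right-invariant direction `X`. Because
`Ad_{hx} = Ad_h Ad_x` and the derivative of `Ad` at `1` is the bracket (`D_adj_one`), the result is
minus the `Z`-component of `[X, Ad_x Y]`. By the twisted bracket this component is `F(X, Ad_g Y)`
(`D_adCoord`). The derivative of `Ad` rests in turn on `fderiv_rightForm_leftField`: left-invariant
fields preserve the right-invariant Maurer-Cartan form, by symmetry of the mixed second derivatives
of multiplication.

The integrals of motion are Noether's theorem with a magnetic correction. A left-invariant field is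
Killing for a right-invariant metric, so `p(ξ_Y)` changes only through the magnetic force. The
cochain equation says `d f(Y) = F(ξ_Y, ·)`, which is exactly the compensating term.
`coordinate_identity` expresses this in a chart; both the vanishing bracket and the conservation law
follow from it. -/

noncomputable section

namespace MagneticFlow

/-! ### Derivatives between manifolds as linear maps of the model spaces -/

section Deriv

variable (E E' E'' : Type*) [NormedAddCommGroup E] [NormedSpace ℝ E]
  [NormedAddCommGroup E'] [NormedSpace ℝ E'] [NormedAddCommGroup E''] [NormedSpace ℝ E'']
  {M M' M'' : Type*} [TopologicalSpace M] [ChartedSpace E M]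
  [TopologicalSpace M'] [ChartedSpace E' M'] [TopologicalSpace M''] [ChartedSpace E'' M'']

/-- The derivative of a map between manifolds, as a map between the model spaces. -/
def D (f : M → M') (x : M) : E →L[ℝ] E' := mfderiv 𝓘(ℝ, E) 𝓘(ℝ, E') f x

/-- Smoothness at a point. -/
abbrev Smooth (f : M → M') (x : M) : Prop := ContMDiffAt 𝓘(ℝ, E) 𝓘(ℝ, E') ∞ f x

variable {E E' E''}

lemma Smooth.mdiff {f : M → M'} {x : M} (hf : Smooth E E' f x) :
    MDifferentiableAt 𝓘(ℝ, E) 𝓘(ℝ, E') f x :=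
  hf.mdifferentiableAt (by simp)

lemma D_comp {g : M' → M''} {f : M → M'} (x : M) (hg : Smooth E' E'' g (f x))
    (hf : Smooth E E' f x) :
    D E E'' (fun y => g (f y)) x = (D E' E'' g (f x)).comp (D E E' f x) :=
  mfderiv_comp x hg.mdiff hf.mdiff

lemma D_comp_apply {g : M' → M''} {f : M → M'} (x : M) (hg : Smooth E' E'' g (f x))
    (hf : Smooth E E' f x) (v : E) :
    D E E'' (fun y => g (f y)) x v = D E' E'' g (f x) (D E E' f x v) := by
  rw [D_comp x hg hf]; rfl

lemma D_comp_of_eq {g : M' → M''} {f : M → M'} {x : M} {y : M'} (hg : Smooth E' E'' g y)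
    (hf : Smooth E E' f x) (hy : f x = y) (v : E) :
    D E E'' (fun y => g (f y)) x v = D E' E'' g y (D E E' f x v) := by
  subst hy; exact D_comp_apply x hg hf v

lemma D_congr {f g : M → M'} {x : M} (h : f =ᶠ[nhds x] g) : D E E' f x = D E E' g x :=
  h.mfderiv_eq

lemma D_id (x : M) : D E E (fun y : M => y) x = ContinuousLinearMap.id ℝ E :=
  mfderiv_id

lemma D_eq_fderiv (f : E → E') (x : E) : D E E' f x = fderiv ℝ f x :=
  mfderiv_eq_fderiv

lemma smooth_iff_contDiffAt {f : E → E'} {x : E} : Smooth E E' f x ↔ ContDiffAt ℝ ∞ f x :=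
  contMDiffAt_iff_contDiffAt

lemma Smooth.comp_of_eq {g : M' → M''} {f : M → M'} {x : M} {y : M'} (hg : Smooth E' E'' g y)
    (hf : Smooth E E' f x) (hy : f x = y) : Smooth E E'' (fun y => g (f y)) x :=
  ContMDiffAt.comp_of_eq hg hf hy

lemma smooth_chart [IsManifold 𝓘(ℝ, E) ∞ M] {c : OpenPartialHomeomorph M E} (hc : c ∈ atlas E M)
    {g : M} (hg : g ∈ c.source) : Smooth E E c g :=
  contMDiffAt_of_mem_maximalAtlas (IsManifold.subset_maximalAtlas hc) hg

lemma smooth_chart_symm [IsManifold 𝓘(ℝ, E) ∞ M] {c : OpenPartialHomeomorph M E}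
    (hc : c ∈ atlas E M) {x : E} (hx : x ∈ c.target) : Smooth E E c.symm x :=
  contMDiffAt_symm_of_mem_maximalAtlas (IsManifold.subset_maximalAtlas hc) hx

lemma D_chart_comp_symm [IsManifold 𝓘(ℝ, E) ∞ M] {c : OpenPartialHomeomorph M E}
    (hc : c ∈ atlas E M) {x : E} (hx : x ∈ c.target) (v : E) :
    D E E c (c.symm x) (D E E c.symm x v) = v := by
  rw [← D_comp_apply x (smooth_chart hc (c.map_target hx)) (smooth_chart_symm hc hx),
    D_congr (g := fun y => y), D_id]
  · rfl
  · filter_upwards [c.open_target.mem_nhds hx] with y hy using c.right_inv hy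

lemma D_symm_comp_chart [IsManifold 𝓘(ℝ, E) ∞ M] {c : OpenPartialHomeomorph M E}
    (hc : c ∈ atlas E M) {g : M} (hg : g ∈ c.source) (v : E) :
    D E E c.symm (c g) (D E E c g v) = v := by
  rw [← D_comp_apply g (smooth_chart_symm hc (c.map_source hg)) (smooth_chart hc hg),
    D_congr (g := fun y => y), D_id]
  · rfl
  · filter_upwards [c.open_source.mem_nhds hg] with y hy using c.left_inv hy

lemma D_chartAt_self [IsManifold 𝓘(ℝ, E) ∞ M] (g : M) (v : E) :
    D E E (chartAt E g) g v = v := by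
  have : IsManifold 𝓘(ℝ, E) 1 M := IsManifold.of_le (n := ∞) (by simp)
  have h := mfderiv_extChartAt_self (I := 𝓘(ℝ, E)) (x := g)
  have h2 : D E E (chartAt E g) g = ContinuousLinearMap.id ℝ E := by
    simpa only [mfld_simps] using! h
  rw [h2]; rfl

lemma D_chartAt_symm_self [IsManifold 𝓘(ℝ, E) ∞ M] (g : M) (v : E) :
    D E E (chartAt E g).symm (chartAt E g g) v = v := by
  have h := D_symm_comp_chart (chart_mem_atlas E g) (mem_chart_source E g) v
  rwa [D_chartAt_self] at h

end Deriv

/-! ### Smooth dependence of a derivative on parameters -/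

section Param

variable {E E' P : Type*} [NormedAddCommGroup E] [NormedSpace ℝ E]
  [NormedAddCommGroup E'] [NormedSpace ℝ E'] [NormedAddCommGroup P] [NormedSpace ℝ P]
  {M M' N : Type*} [TopologicalSpace M] [ChartedSpace E M] [IsManifold 𝓘(ℝ, E) ∞ M]
  [TopologicalSpace M'] [ChartedSpace E' M'] [IsManifold 𝓘(ℝ, E') ∞ M']
  [TopologicalSpace N] [ChartedSpace P N] [IsManifold 𝓘(ℝ, P) ∞ N]

/-- The derivative in the second variable depends smoothly on the first variable. -/
lemma smooth_D_param (f : N → M → M') (g : N → M) (x₀ : N)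
    (hf : ContMDiffAt (𝓘(ℝ, P).prod 𝓘(ℝ, E)) 𝓘(ℝ, E') ∞ (Function.uncurry f) (x₀, g x₀))
    (hg : Smooth P E g x₀)
    (h₁ : ∀ x, g x ∈ (chartAt E (g x₀)).source ∧
      D E E (chartAt E (g x₀)).symm (chartAt E (g x₀) (g x)) = ContinuousLinearMap.id ℝ E)
    (h₂ : ∀ᶠ x in nhds x₀, f x (g x) ∈ (chartAt E' (f x₀ (g x₀))).source ∧
      D E' E' (chartAt E' (f x₀ (g x₀))) (f x (g x)) = ContinuousLinearMap.id ℝ E') :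
    Smooth P (E →L[ℝ] E') (fun x => D E E' (f x) (g x)) x₀ := by
  have : IsManifold 𝓘(ℝ, E) 1 M := IsManifold.of_le (n := ∞) (by simp)
  have : IsManifold 𝓘(ℝ, E') 1 M' := IsManifold.of_le (n := ∞) (by simp)
  have h := ContMDiffAt.mfderiv (m := ∞) f g hf hg (by simp)
  refine h.congr_of_eventuallyEq ?_
  filter_upwards [h₂] with x hx
  -- In tangent coordinates the derivative is conjugated by chart differentials; `h₁` and `h₂` say
  -- that these are the identity at the points concerned, so the raw derivative is smooth.
  rw [inTangentCoordinates_eq_mfderiv_comp (h₁ x).1 hx.1]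
  have e₁ := (h₁ x).2
  have e₂ := hx.2
  ext1 v
  have e₁' : ∀ v : E, mfderivWithin 𝓘(ℝ, E) 𝓘(ℝ, E) (extChartAt 𝓘(ℝ, E) (g x₀)).symm
      (Set.range 𝓘(ℝ, E)) (extChartAt 𝓘(ℝ, E) (g x₀) (g x)) v = v := by
    intro v
    have := congrArg (fun L : E →L[ℝ] E => L v) e₁
    simpa only [mfld_simps, mfderivWithin_univ] using! this
  have e₂' : ∀ w : E', mfderiv 𝓘(ℝ, E') 𝓘(ℝ, E') (extChartAt 𝓘(ℝ, E') (f x₀ (g x₀)))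
      (f x (g x)) w = w := by
    intro w
    have := congrArg (fun L : E' →L[ℝ] E' => L w) e₂
    simpa only [mfld_simps] using! this
  change _ = (mfderiv 𝓘(ℝ, E') 𝓘(ℝ, E') (extChartAt 𝓘(ℝ, E') (f x₀ (g x₀)))
      (f x (g x)) (D E E' (f x) (g x) (mfderivWithin 𝓘(ℝ, E) 𝓘(ℝ, E)
      (extChartAt 𝓘(ℝ, E) (g x₀)).symm
      (Set.range 𝓘(ℝ, E)) (extChartAt 𝓘(ℝ, E) (g x₀) (g x)) v)) : E')
  exact ((e₂' _).trans (congrArg _ (e₁' v))).symm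

end Param

/-! ### Invariant fields and the Maurer-Cartan form in a chart -/

section GroupCalculus

variable {n : ℕ} {G : Type*} [TopologicalSpace G] [ChartedSpace (Model n) G] [Group G]

/-- The left-invariant vector fields in the chart `c`, as a function of their value at `1`. -/
def leftField (c : OpenPartialHomeomorph G (Model n)) (x : Model n) : Model n →L[ℝ] Model n :=
  D (Model n) (Model n) (fun h : G => c (c.symm x * h)) 1

/-- The right-invariant Maurer-Cartan form in the chart `c`. -/
def rightForm (c : OpenPartialHomeomorph G (Model n)) (x : Model n) : Model n →L[ℝ] Model n :=
  D (Model n) (Model n) (fun z : Model n => c.symm z * (c.symm x)⁻¹) x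

/-- The adjoint representation as a map into the endomorphisms of the model space. -/
def adj (g : G) : Model n →L[ℝ] Model n :=
  D (Model n) (Model n) (fun h : G => g * h * g⁻¹) 1

variable [LieGroup 𝓘(ℝ, Model n) ∞ G]

lemma smooth_mul_left (a g : G) : Smooth (Model n) (Model n) (fun h : G => a * h) g :=
  contMDiffAt_const.mul contMDiffAt_id

lemma smooth_mul_right (a g : G) : Smooth (Model n) (Model n) (fun h : G => h * a) g :=
  contMDiffAt_id.mul contMDiffAt_const

lemma smooth_conj (a g : G) : Smooth (Model n) (Model n) (fun h : G => a * h * a⁻¹) g :=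
  (contMDiffAt_const.mul contMDiffAt_id).mul contMDiffAt_const

variable {c : OpenPartialHomeomorph G (Model n)} (hc : c ∈ atlas (Model n) G)
include hc

lemma leftField_apply {x : Model n} (hx : x ∈ c.target) (v : Model n) :
    leftField c x v = D (Model n) (Model n) c (c.symm x)
      (D (Model n) (Model n) (fun h : G => c.symm x * h) 1 v) :=
  D_comp_of_eq (smooth_chart hc (c.map_target hx)) (smooth_mul_left _ _) (by simp) v

lemma rightForm_apply {x : Model n} (hx : x ∈ c.target) (v : Model n) :
    rightForm c x v = D (Model n) (Model n) (fun h : G => h * (c.symm x)⁻¹) (c.symm x)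
      (D (Model n) (Model n) c.symm x v) :=
  D_comp_apply x (smooth_mul_right (c.symm x)⁻¹ (c.symm x)) (smooth_chart_symm hc hx) v

/-- Left translation by `g` followed by right translation by `g⁻¹` is conjugation. This factors `Ad`
into two operator fields that can be differentiated in the chart. -/
lemma rightForm_leftField {x : Model n} (hx : x ∈ c.target) (v : Model n) :
    rightForm c x (leftField c x v) = adj (c.symm x) v := by
  rw [rightForm_apply hc hx, leftField_apply hc hx]
  have h := D_symm_comp_chart hc (c.map_target hx)
    (D (Model n) (Model n) (fun h : G => c.symm x * h) 1 v)
  rw [c.right_inv hx] at h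
  rw [h]
  exact (D_comp_of_eq (smooth_mul_right _ _) (smooth_mul_left _ _) (by simp) v).symm

lemma smooth_leftField {x₀ : Model n} (hx₀ : x₀ ∈ c.target) :
    ContDiffAt ℝ ∞ (leftField c) x₀ := by
  rw [← smooth_iff_contDiffAt]
  refine smooth_D_param (fun (x : Model n) (h : G) => c (c.symm x * h)) (fun _ => 1) x₀ ?_
    contMDiffAt_const (fun x => ⟨mem_chart_source _ _, ?_⟩) ?_
  · refine ContMDiffAt.comp_of_eq (f := fun p : Model n × G => c.symm p.1 * p.2) (y := c.symm x₀)
      (smooth_chart hc (c.map_target hx₀)) ?_ (by simp)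
    exact (ContMDiffAt.comp_of_eq (f := fun p : Model n × G => p.1) (y := x₀)
      (smooth_chart_symm hc hx₀) contMDiffAt_fst rfl).mul contMDiffAt_snd
  · ext1 v; exact D_chartAt_symm_self _ v
  · refine Filter.Eventually.of_forall fun x => ⟨Set.mem_univ _, ?_⟩
    exact D_id _

lemma smooth_rightForm {x₀ : Model n} (hx₀ : x₀ ∈ c.target) :
    ContDiffAt ℝ ∞ (rightForm c) x₀ := by
  rw [← smooth_iff_contDiffAt]
  refine smooth_D_param (fun (x z : Model n) => c.symm z * (c.symm x)⁻¹) (fun x => x) x₀ ?_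
    contMDiffAt_id (fun x => ⟨Set.mem_univ _, ?_⟩) ?_
  · exact (ContMDiffAt.comp_of_eq (f := fun p : Model n × Model n => p.2) (y := x₀)
      (smooth_chart_symm hc hx₀) contMDiffAt_snd rfl).mul
      (ContMDiffAt.comp_of_eq (f := fun p : Model n × Model n => p.1) (y := x₀)
      (smooth_chart_symm hc hx₀) contMDiffAt_fst rfl).inv
  · exact D_id _
  · refine Filter.Eventually.of_forall fun x => ⟨by simp, ?_⟩
    ext1 v
    simpa using D_chartAt_self (1 : G) v

/-- Multiplication, in the chart `c` on the first factor and the chart at `1` on the second. -/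
lemma smooth_localMul {x₀ : Model n} (hx₀ : x₀ ∈ c.target) :
    ContDiffAt ℝ ∞ (fun z : Model n × Model n =>
      c (c.symm z.1 * (chartAt (Model n) (1 : G)).symm z.2)) (x₀, chartAt (Model n) (1 : G) 1) := by
  rw [← smooth_iff_contDiffAt]
  refine Smooth.comp_of_eq (y := c.symm x₀) (smooth_chart hc (c.map_target hx₀)) ?_ (by simp)
  refine ContMDiffAt.mul ?_ ?_
  · exact Smooth.comp_of_eq (y := x₀) (smooth_chart_symm hc hx₀) contDiff_fst.contMDiff.contMDiffAt
      rfl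
  · exact Smooth.comp_of_eq (y := chartAt (Model n) (1 : G) 1)
      (smooth_chart_symm (chart_mem_atlas _ _) (mem_chart_target _ _))
      contDiff_snd.contMDiff.contMDiffAt rfl

/-- Left-invariant vector fields preserve the right-invariant Maurer-Cartan form. -/
lemma fderiv_rightForm_leftField {x₀ : Model n} (hx₀ : x₀ ∈ c.target) (u v : Model n) :
    fderiv ℝ (rightForm c) x₀ (leftField c x₀ v) u
      = -rightForm c x₀ (fderiv ℝ (fun x => leftField c x v) x₀ u) := by
  have two_le : minSmoothness ℝ 2 ≤ ∞ := by
    rw [minSmoothness_of_isRCLikeNormedField]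
    exact WithTop.coe_le_coe.mpr (le_top : (2 : ℕ∞) ≤ ⊤)
  set φ := chartAt (Model n) (1 : G) with hφ
  set e := φ 1 with he
  set μ : Model n × Model n → Model n := fun z => c (c.symm z.1 * φ.symm z.2) with hμ
  have hsm : ContDiffAt ℝ ∞ μ (x₀, e) := smooth_localMul hc hx₀
  have hφe : φ.symm e = 1 := φ.left_inv (mem_chart_source _ _)
  have hφa : φ ∈ atlas (Model n) G := chart_mem_atlas _ _
  have het : e ∈ φ.target := mem_chart_target _ _
  -- The field is the partial derivative of the local multiplication `μ` in its second variable at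
  -- the identity; the chart at `1` has identity differential there, so `v` needs no conversion.
  have hA : ∀ x ∈ c.target, leftField c x v = fderiv ℝ μ (x, e) (0, v) := by
    intro x hx
    have hsx : ContDiffAt ℝ ∞ μ (x, e) := smooth_localMul hc hx
    have h1 : HasFDerivAt (fun y : Model n => μ (x, y))
        ((fderiv ℝ μ (x, e)).comp (ContinuousLinearMap.inr ℝ (Model n) (Model n))) e :=
      (hsx.differentiableAt (by simp)).hasFDerivAt.comp e (hasFDerivAt_prodMk_right x e)
    have h2 := D_comp_of_eq (g := fun h : G => c (c.symm x * h)) (f := φ.symm) (x := e) (y := 1)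
      (Smooth.comp_of_eq (y := c.symm x) (smooth_chart hc (c.map_target hx))
        (smooth_mul_left _ _) (by simp)) (smooth_chart_symm hφa het) hφe v
    rw [D_chartAt_symm_self, D_eq_fderiv] at h2
    rw [leftField, ← h2]
    exact congrArg (fun L => L v) h1.fderiv
  have hμe : μ (x₀, e) = x₀ := by simp [hμ, hφe, c.right_inv hx₀]
  have hmem : ∀ᶠ y in nhds e, c.symm x₀ * φ.symm y ∈ c.source := by
    have : ContinuousAt (fun y => c.symm x₀ * φ.symm y) e :=
      (ContMDiffAt.mul contMDiffAt_const (smooth_chart_symm hφa het) :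
        Smooth (Model n) (Model n) (fun y => c.symm x₀ * φ.symm y) e).continuousAt
    refine this.eventually_mem (c.open_source.mem_nhds ?_)
    rw [hφe, mul_one]; exact c.map_target hx₀
  -- The partial derivative in the first variable is the differential of a right translation, and
  -- the form is right-invariant: the expression is therefore constant in `y`, and differentiating
  -- it at `e` gives the lemma.
  have hB : ∀ᶠ y in nhds e, rightForm c (μ (x₀, y)) (fderiv ℝ μ (x₀, y) (u, 0))
      = rightForm c x₀ u := by
    have hd : ∀ᶠ y in nhds e, DifferentiableAt ℝ μ (x₀, y) := by
      have h1 : ∀ᶠ z in nhds (x₀, e), DifferentiableAt ℝ μ z :=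
        ((hsm.of_le (m := 1) (by simp)).eventually (by simp)).mono
          fun z hz => hz.differentiableAt (by simp)
      exact (Continuous.prodMk_right x₀).continuousAt.eventually h1
    filter_upwards [hmem, hd] with y hy hdy
    have h1 : fderiv ℝ μ (x₀, y) (u, 0)
        = D (Model n) (Model n) (fun z => c (c.symm z * φ.symm y)) x₀ u := by
      rw [D_eq_fderiv]
      have : HasFDerivAt (fun z : Model n => μ (z, y))
        ((fderiv ℝ μ (x₀, y)).comp (ContinuousLinearMap.inl ℝ (Model n) (Model n))) x₀ :=
        HasFDerivAt.comp (g := μ) (f := fun z => (z, y)) x₀ hdy.hasFDerivAt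
          (hasFDerivAt_prodMk_left x₀ y)
      exact (congrArg (fun L => L u) this.fderiv).symm
    have hs1 : Smooth (Model n) (Model n) (fun z => c.symm z * φ.symm y) x₀ :=
      (smooth_chart_symm hc hx₀).mul contMDiffAt_const
    rw [h1, rightForm, ← D_comp_apply x₀
      (g := fun z => c.symm z * (c.symm (μ (x₀, y)))⁻¹) (f := fun z => c (c.symm z * φ.symm y))
      ((smooth_chart_symm hc (c.map_source hy)).mul contMDiffAt_const)
      (Smooth.comp_of_eq (y := c.symm x₀ * φ.symm y) (smooth_chart hc hy) hs1 rfl)]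
    rw [rightForm]
    congr 1
    refine D_congr ?_
    filter_upwards [hs1.continuousAt.eventually_mem (c.open_source.mem_nhds hy)] with z hz
    simp only [hμ]
    rw [c.left_inv hz, c.left_inv hy]
    group
  have hd2 : DifferentiableAt ℝ (fderiv ℝ μ) (x₀, e) :=
    (hsm.fderiv_right (m := ∞) (by simp)).differentiableAt (by simp)
  have hC : HasFDerivAt (fun y => fderiv ℝ μ (x₀, y) (u, 0))
      (((fderiv ℝ (fderiv ℝ μ) (x₀, e)).flip (u, 0)).comp
        (ContinuousLinearMap.inr ℝ (Model n) (Model n))) e := by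
    have h1 : HasFDerivAt (fun y => fderiv ℝ μ (x₀, y))
      ((fderiv ℝ (fderiv ℝ μ) (x₀, e)).comp (ContinuousLinearMap.inr ℝ (Model n) (Model n))) e :=
      hd2.hasFDerivAt.comp e (hasFDerivAt_prodMk_right x₀ e)
    refine (h1.clm_apply (hasFDerivAt_const ((u, 0) : Model n × Model n) e)).congr_fderiv ?_
    ext1 w; simp
  have hD : fderiv ℝ (fun x => leftField c x v) x₀ u
      = fderiv ℝ (fderiv ℝ μ) (x₀, e) (u, 0) (0, v) := by
    have h1 : HasFDerivAt (fun x => fderiv ℝ μ (x, e))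
      ((fderiv ℝ (fderiv ℝ μ) (x₀, e)).comp (ContinuousLinearMap.inl ℝ (Model n) (Model n))) x₀ :=
      hd2.hasFDerivAt.comp x₀ (hasFDerivAt_prodMk_left x₀ e)
    have h2 := h1.clm_apply (hasFDerivAt_const ((0, v) : Model n × Model n) x₀)
    have h3 : (fun x => leftField c x v) =ᶠ[nhds x₀] fun x => fderiv ℝ μ (x, e) (0, v) := by
      filter_upwards [c.open_target.mem_nhds hx₀] with x hx using hA x hx
    rw [h3.fderiv_eq, h2.fderiv]
    simp
  have hμy : HasFDerivAt (fun y : Model n => μ (x₀, y))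
      ((fderiv ℝ μ (x₀, e)).comp (ContinuousLinearMap.inr ℝ (Model n) (Model n))) e :=
    (hsm.differentiableAt (by simp)).hasFDerivAt.comp e (hasFDerivAt_prodMk_right x₀ e)
  have hθ : HasFDerivAt (rightForm c) (fderiv ℝ (rightForm c) x₀) (μ (x₀, e)) := by
    rw [hμe]
    exact ((smooth_rightForm hc hx₀).differentiableAt (by simp)).hasFDerivAt
  have hE := ((hθ.comp e hμy).clm_apply hC).fderiv
  have hE' : fderiv ℝ (fun y => rightForm c (μ (x₀, y)) (fderiv ℝ μ (x₀, y) (u, 0))) e = 0 := by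
    rw [Filter.EventuallyEq.fderiv_eq (f := fun _ => rightForm c x₀ u) hB]
    simp
  have hu : fderiv ℝ μ (x₀, e) (u, 0) = u := by
    have h1 : HasFDerivAt (fun z : Model n => μ (z, e))
        ((fderiv ℝ μ (x₀, e)).comp (ContinuousLinearMap.inl ℝ (Model n) (Model n))) x₀ :=
      HasFDerivAt.comp (g := μ) (f := fun z => (z, e)) x₀
        (hsm.differentiableAt (by simp)).hasFDerivAt (hasFDerivAt_prodMk_left x₀ e)
    have h2 : (fun z : Model n => μ (z, e)) =ᶠ[nhds x₀] fun z => z := by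
      filter_upwards [c.open_target.mem_nhds hx₀] with z hz
      simp [hμ, hφe, c.right_inv hz]
    have h3 := h1.fderiv
    rw [h2.fderiv_eq, fderiv_fun_id] at h3
    exact (congrArg (fun L => L u) h3).symm
  -- Symmetry of the second derivative turns the `v`-derivative of the translation of `u` into the
  -- `u`-derivative of the left-invariant field of `v`.
  have hsymm := (hsm.isSymmSndFDerivAt two_le).eq (u, 0) (0, v)
  have h0 := congrArg (fun L => L v) (hE.symm.trans hE')
  rw [hD, hsymm, hA x₀ hx₀]
  simp [hμe, hu] at h0
  rw [eq_neg_iff_add_eq_zero, add_comm]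
  exact h0

end GroupCalculus

/-! ### The adjoint representation and its derivative -/

section AdjointDerivative

variable {n : ℕ} {G : Type*} [TopologicalSpace G] [ChartedSpace (Model n) G] [Group G]
  [LieGroup 𝓘(ℝ, Model n) ∞ G]

lemma smooth_adj (g : G) :
    Smooth (Model n) (Model n →L[ℝ] Model n) (adj : G → Model n →L[ℝ] Model n) g := by
  refine smooth_D_param (fun (x h : G) => x * h * x⁻¹) (fun _ => 1) g ?_
    contMDiffAt_const (fun x => ⟨mem_chart_source _ _, ?_⟩) ?_
  · exact (contMDiffAt_fst.mul contMDiffAt_snd).mul contMDiffAt_fst.inv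
  · ext1 v; exact D_chartAt_symm_self _ v
  · refine Filter.Eventually.of_forall fun x => ⟨by simp, ?_⟩
    ext1 v
    simpa using D_chartAt_self (1 : G) v

lemma adj_mul (g h : G) (v : Model n) : adj (g * h) v = adj g (adj h v) := by
  rw [adj, adj, adj, ← D_comp_of_eq (smooth_conj _ _) (smooth_conj _ _) (by simp) v]
  congr 2
  ext x; group

omit [LieGroup 𝓘(ℝ, Model n) ∞ G] in
lemma adj_one (v : Model n) : adj (1 : G) v = v := by
  have : (fun h : G => 1 * h * 1⁻¹) = fun h => h := by ext; simp
  rw [adj, this, D_id]; rfl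

lemma smooth_adj_apply (g : G) (v : Model n) :
    Smooth (Model n) (Model n) (fun x : G => adj x v) g :=
  ContMDiffAt.clm_apply (smooth_adj g) contMDiffAt_const

lemma leftField_chartAt_one (v : Model n) :
    leftField (chartAt (Model n) (1 : G)) (chartAt (Model n) (1 : G) 1) v = v := by
  rw [leftField, (chartAt (Model n) (1 : G)).left_inv (mem_chart_source _ _)]
  simp only [one_mul]
  exact D_chartAt_self _ v

lemma rightForm_chartAt_one (v : Model n) :
    rightForm (chartAt (Model n) (1 : G)) (chartAt (Model n) (1 : G) 1) v = v := by
  have h := rightForm_leftField (chart_mem_atlas (Model n) (1 : G)) (mem_chart_target _ _) v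
  rwa [leftField_chartAt_one, (chartAt (Model n) (1 : G)).left_inv (mem_chart_source _ _),
    adj_one] at h

variable (G) in
/-- The bracket of the Lie algebra of `G`, on the model space. -/
def modelBracket (w v : Model n) : Model n := 
  Bracket.bracket (L := LieAlg n G) (M := LieAlg n G) w v

/-- The bracket of left-invariant fields is evaluated at `1` in the chart centred there. The
pulled-back fields are `leftField`, and the chart differential at `1` is the identity, so the
coordinate formula needs no transport. -/
lemma modelBracket_eq (w v : Model n) :
    modelBracket G w v =
      fderiv ℝ (fun x => leftField (chartAt (Model n) (1 : G)) x v)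
          (chartAt (Model n) (1 : G) 1) w
        - fderiv ℝ (fun x => leftField (chartAt (Model n) (1 : G)) x w)
          (chartAt (Model n) (1 : G) 1) v := by
  have : IsManifold 𝓘(ℝ, Model n) 1 G := IsManifold.of_le (n := ∞) (by simp)
  set φ := chartAt (Model n) (1 : G) with hφ
  have hφa : φ ∈ atlas (Model n) G := chart_mem_atlas _ _
  have key : ∀ v : Model n, (VectorField.mpullbackWithin 𝓘(ℝ, Model n) 𝓘(ℝ, Model n)
      (extChartAt 𝓘(ℝ, Model n) (1 : G)).symm
      (mulInvariantVectorField (I := 𝓘(ℝ, Model n)) (v : LieAlg n G))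
      (Set.range 𝓘(ℝ, Model n)) : Model n → Model n) =ᶠ[nhds (φ 1)] fun x => leftField φ x v := by
    intro v
    filter_upwards [φ.open_target.mem_nhds (mem_chart_target _ _)] with x hx
    have e1 : (mfderivWithin 𝓘(ℝ, Model n) 𝓘(ℝ, Model n)
      (extChartAt 𝓘(ℝ, Model n) (1 : G)).symm (Set.range 𝓘(ℝ, Model n)) x : Model n →L[ℝ] Model n)
      = D (Model n) (Model n) φ.symm x := by
      simp only [mfld_simps, mfderivWithin_univ]; rfl
    have e2 : ContinuousLinearMap.inverse (D (Model n) (Model n) φ.symm x)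
        = D (Model n) (Model n) φ (φ.symm x) := by
      refine ContinuousLinearMap.inverse_eq ?_ ?_
      · ext1 u
        have := D_symm_comp_chart hφa (φ.map_target hx) u
        rwa [φ.right_inv hx] at this
      · ext1 u; exact D_chart_comp_symm hφa hx u
    rw [leftField_apply hφa hx, ← e2, ← e1]
    rfl
  change (mfderiv 𝓘(ℝ, Model n) 𝓘(ℝ, Model n)
      (extChartAt 𝓘(ℝ, Model n) (1 : G)) 1 : Model n →L[ℝ] Model n).inverse
    (VectorField.lieBracketWithin ℝ (E := Model n)
      (VectorField.mpullbackWithin 𝓘(ℝ, Model n) 𝓘(ℝ, Model n)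
        (extChartAt 𝓘(ℝ, Model n) (1 : G)).symm (mulInvariantVectorField (w : LieAlg n G))
        (Set.range 𝓘(ℝ, Model n)))
      (VectorField.mpullbackWithin 𝓘(ℝ, Model n) 𝓘(ℝ, Model n)
        (extChartAt 𝓘(ℝ, Model n) (1 : G)).symm (mulInvariantVectorField (v : LieAlg n G))
        (Set.range 𝓘(ℝ, Model n)))
      ((extChartAt 𝓘(ℝ, Model n) (1 : G)).symm ⁻¹' Set.univ ∩ Set.range 𝓘(ℝ, Model n))
      (extChartAt 𝓘(ℝ, Model n) (1 : G) 1)) = _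
  have e3 : ∀ u : Model n, (mfderiv 𝓘(ℝ, Model n) 𝓘(ℝ, Model n)
      (extChartAt 𝓘(ℝ, Model n) (1 : G)) 1 : Model n →L[ℝ] Model n).inverse u = u := by
    intro u
    have h1 : (mfderiv 𝓘(ℝ, Model n) 𝓘(ℝ, Model n)
      (extChartAt 𝓘(ℝ, Model n) (1 : G)) 1 : Model n →L[ℝ] Model n)
        = ContinuousLinearMap.id ℝ (Model n) := mfderiv_extChartAt_self
    exact (congrArg (fun L : Model n →L[ℝ] Model n => L.inverse u) h1).trans
      (congrArg (fun L : Model n →L[ℝ] Model n => L u) ContinuousLinearMap.inverse_id)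
  refine (e3 _).trans ?_
  have e4 : ((extChartAt 𝓘(ℝ, Model n) (1 : G)).symm ⁻¹' Set.univ ∩ Set.range 𝓘(ℝ, Model n))
      = Set.univ := by simp
  have e5 : extChartAt 𝓘(ℝ, Model n) (1 : G) 1 = φ 1 := by simp only [mfld_simps]; rfl
  rw [e4, e5]
  refine (congrFun (VectorField.lieBracketWithin_univ (𝕜 := ℝ) (E := Model n)) _).trans ?_
  refine (Filter.EventuallyEq.lieBracket_vectorField_eq (𝕜 := ℝ) (E := Model n)
    (key w) (key v)).trans ?_
  simp only [VectorField.lieBracket]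
  rw [hφ, leftField_chartAt_one, leftField_chartAt_one]

/-- The derivative of the adjoint representation at `1` is the Lie bracket. -/
lemma D_adj_one (w v : Model n) :
    D (Model n) (Model n) (fun g : G => adj g v) 1 w = modelBracket G w v := by
  set φ := chartAt (Model n) (1 : G) with hφ
  have hφa : φ ∈ atlas (Model n) G := chart_mem_atlas _ _
  have het : φ 1 ∈ φ.target := mem_chart_target _ _
  have h1 := D_comp_of_eq (g := fun g : G => adj g v) (f := φ.symm) (x := φ 1) (y := 1)
    (smooth_adj_apply 1 v) (smooth_chart_symm hφa het) (φ.left_inv (mem_chart_source _ _)) w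
  rw [hφ, D_chartAt_symm_self, D_eq_fderiv] at h1
  rw [← h1, modelBracket_eq]
  have h2 : (fun x => adj (φ.symm x) v) =ᶠ[nhds (φ 1)] fun x => rightForm φ x (leftField φ x v) := by
    filter_upwards [φ.open_target.mem_nhds het] with x hx
    exact (rightForm_leftField hφa hx v).symm
  have hl : DifferentiableAt ℝ (fun x => leftField φ x v) (φ 1) :=
    ((smooth_leftField hφa het).differentiableAt (by simp)).clm_apply (differentiableAt_const _)
  have h3 := (((smooth_rightForm hφa het).differentiableAt (by simp)).hasFDerivAt.clm_apply
    hl.hasFDerivAt).fderiv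
  rw [h2.fderiv_eq, h3]
  -- Used with the roles exchanged: `w` generates the invariant field and `v` is the argument. This
  -- turns the derivative of the form in the product rule into the second term of the bracket.
  have h4 := fderiv_rightForm_leftField hφa het v w
  rw [leftField_chartAt_one, rightForm_chartAt_one] at h4
  change rightForm φ (φ 1) (fderiv ℝ (fun x => leftField φ x v) (φ 1) w)
    + fderiv ℝ (rightForm φ) (φ 1) w (leftField φ (φ 1) v) = _
  rw [leftField_chartAt_one, rightForm_chartAt_one, h4, sub_eq_add_neg]

end AdjointDerivative

/-! ### Left and right translations -/

section Translations

variable {n : ℕ} {G : Type*} [TopologicalSpace G] [ChartedSpace (Model n) G] [Group G]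
  [LieGroup 𝓘(ℝ, Model n) ∞ G]

/-- Differentiate `x h = (x h x⁻¹) x`. -/
lemma D_mul_left_eq (x : G) (v : Model n) :
    D (Model n) (Model n) (fun h : G => x * h) 1 v
      = D (Model n) (Model n) (fun h : G => h * x) 1 (adj x v) := by
  rw [adj, ← D_comp_of_eq (smooth_mul_right _ _) (smooth_conj _ _) (by simp) v]
  congr 2
  ext h; group

lemma D_mul_right_inv (x : G) (v : Model n) :
    D (Model n) (Model n) (fun h : G => h * x⁻¹) x
      (D (Model n) (Model n) (fun h : G => h * x) 1 v) = v := by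
  rw [← D_comp_of_eq (smooth_mul_right _ _) (smooth_mul_right _ _) (by simp) v]
  simp only [mul_inv_cancel_right]
  rw [D_id]; rfl

lemma D_mul_right_inv' (x : G) (v : Model n) :
    D (Model n) (Model n) (fun h : G => h * x) 1
      (D (Model n) (Model n) (fun h : G => h * x⁻¹) x v) = v := by
  rw [← D_comp_of_eq (smooth_mul_right _ _) (smooth_mul_right _ _) (by simp) v]
  simp only [inv_mul_cancel_right]
  rw [D_id]; rfl

/-- Differentiating along a right-invariant vector field. -/
lemma D_right_translate {E' M' : Type*} [NormedAddCommGroup E'] [NormedSpace ℝ E']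
    [TopologicalSpace M'] [ChartedSpace E' M'] {f : G → M'} {x : G}
    (hf : Smooth (Model n) E' f x) (v : Model n) :
    D (Model n) E' f x (D (Model n) (Model n) (fun h : G => h * x) 1 v)
      = D (Model n) E' (fun h : G => f (h * x)) 1 v :=
  (D_comp_of_eq hf (smooth_mul_right _ _) (by simp) v).symm

end Translations

/-! ### The Lie algebra extended by the cocycle -/

namespace Cocycle

variable {n : ℕ} {G : Type*} [TopologicalSpace G] [ChartedSpace (Model n) G] [Group G]
  [LieGroup 𝓘(ℝ, Model n) ∞ G] (F : Cocycle n G)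

lemma mk_add (X Y : LieAlg n G) (a b : ℝ) : F.mk (X + Y) (a + b) = F.mk X a + F.mk Y b := by
  simp only [mk]
  rw [← LieAlgebra.of_add, Prod.mk_add_mk, map_add]

lemma mk_smul (r : ℝ) (X : LieAlg n G) (a : ℝ) : F.mk (r • X) (r * a) = r • F.mk X a := by
  simp only [mk]
  rw [← LieAlgebra.of_smul, Prod.smul_mk, ← smul_eq_mul, map_smul]

lemma bracket_mk_snd (X Y : LieAlg n G) (a b : ℝ) :
    TrivialLieModule.equiv ℝ (LieAlg n G) ℝ
      ((LieAlgebra.ofProd F).symm ⁅F.mk X a, F.mk Y b⁆).2 = F.form X Y := by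
  rw [LieAlgebra.bracket_ofTwoCocycle]
  simp [mk, form, LieModule.IsTrivial.trivial]

/-- Alternation is read off from `[X, X] = 0` in the extended algebra. -/
lemma form_self (X : LieAlg n G) : F.form X X = 0 := by
  rw [← F.bracket_mk_snd X X 0 0, lie_self]
  simp

end Cocycle

/-! ### The central coordinate of the adjoint representation -/

namespace CentralExtension

variable {n : ℕ} {G : Type*} [TopologicalSpace G] [ChartedSpace (Model n) G] [Group G]
  [LieGroup 𝓘(ℝ, Model n) ∞ G]
  {Gt : Type*} [TopologicalSpace Gt] [ChartedSpace (Model (n + 1)) Gt] [Group Gt]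
  [LieGroup 𝓘(ℝ, Model (n + 1)) ∞ Gt]
  {F : Cocycle n G} (A : CentralExtension Gt F)

/-- The element `X + a Z` on the model spaces. -/
def ofPair (X : Model n) (a : ℝ) : Model (n + 1) := A.lieEquiv (F.mk X a)

/-- The inclusion `𝔤 ⊂ 𝔤 ⊕ ℝ Z` on the model spaces. -/
abbrev incl (X : Model n) : Model (n + 1) := A.ofPair X 0

/-- The central direction `Z`. -/
abbrev central : Model (n + 1) := A.ofPair 0 1

/-- The projection `𝔤 ⊕ ℝ Z → 𝔤` on the model spaces. -/
def Dproj : Model (n + 1) →L[ℝ] Model n := D (Model (n + 1)) (Model n) A.proj 1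

/-- The `Z`-component on `𝔤 ⊕ ℝ Z`. -/
def centralCoord : Model (n + 1) →L[ℝ] ℝ :=
  LinearMap.toContinuousLinearMap
    { toFun := fun v => TrivialLieModule.equiv ℝ (LieAlg n G) ℝ
        ((LieAlgebra.ofProd F).symm (A.lieEquiv.symm v)).2
      map_add' := fun v w => by
        have : A.lieEquiv.symm (v + w) = A.lieEquiv.symm v + A.lieEquiv.symm w :=
          map_add A.lieEquiv.symm _ _
        rw [this, LieAlgebra.of_symm_add, Prod.snd_add, map_add]
      map_smul' := fun r v => by
        have : A.lieEquiv.symm (r • v) = r • A.lieEquiv.symm v :=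
          map_smul A.lieEquiv.symm _ _
        rw [this, LieAlgebra.of_symm_smul, Prod.smul_snd, map_smul]; rfl }

lemma centralCoord_ofPair (X : Model n) (a : ℝ) : A.centralCoord (A.ofPair X a) = a := by
  change TrivialLieModule.equiv ℝ (LieAlg n G) ℝ
    ((LieAlgebra.ofProd F).symm (A.lieEquiv.symm (A.lieEquiv (F.mk X a)))).2 = a
  rw [LieEquiv.symm_apply_apply]
  simp [Cocycle.mk]

lemma Dproj_ofPair (X : Model n) (a : ℝ) : A.Dproj (A.ofPair X a) = X := A.mfderiv_proj X a

lemma ofPair_add (X Y : Model n) (a b : ℝ) :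
    A.ofPair (X + Y) (a + b) = A.ofPair X a + A.ofPair Y b :=
  (congrArg A.lieEquiv (F.mk_add X Y a b)).trans (map_add A.lieEquiv _ _)

lemma ofPair_smul (r : ℝ) (X : Model n) (a : ℝ) :
    A.ofPair (r • X) (r * a) = r • A.ofPair X a :=
  (congrArg A.lieEquiv (F.mk_smul r X a)).trans (map_smul A.lieEquiv _ _)

lemma eq_ofPair (v : Model (n + 1)) : v = A.ofPair (A.Dproj v) (A.centralCoord v) := by
  have h : ∃ X a, v = A.ofPair X a := by
    refine ⟨((LieAlgebra.ofProd F).symm (A.lieEquiv.symm v)).1,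
      TrivialLieModule.equiv ℝ (LieAlg n G) ℝ
        ((LieAlgebra.ofProd F).symm (A.lieEquiv.symm v)).2, ?_⟩
    simp only [ofPair, Cocycle.mk, LinearEquiv.symm_apply_apply, Prod.mk.eta,
      Equiv.apply_symm_apply]
    exact (A.lieEquiv.apply_symm_apply v).symm
  obtain ⟨X, a, rfl⟩ := h
  rw [Dproj_ofPair, centralCoord_ofPair]

lemma eq_incl_add (v : Model (n + 1)) :
    v = A.incl (A.Dproj v) + A.centralCoord v • A.central := by
  conv_lhs => rw [A.eq_ofPair v]
  rw [← ofPair_smul, ← ofPair_add]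
  simp

lemma centralCoord_bracket_incl (X : Model n) (v : Model (n + 1)) :
    A.centralCoord (modelBracket Gt (A.incl X) v) = F.form X (A.Dproj v) := by
  obtain ⟨Y, b, rfl⟩ : ∃ Y b, v = A.ofPair Y b := ⟨_, _, A.eq_ofPair v⟩
  rw [Dproj_ofPair]
  have h : modelBracket Gt (A.incl X) (A.ofPair Y b)
      = A.lieEquiv ⁅F.mk X 0, F.mk Y b⁆ :=
    (LieEquiv.map_lie A.lieEquiv _ _).symm
  rw [h]
  change TrivialLieModule.equiv ℝ (LieAlg n G) ℝ
    ((LieAlgebra.ofProd F).symm (A.lieEquiv.symm (A.lieEquiv _))).2 = _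
  rw [LieEquiv.symm_apply_apply]
  exact F.bracket_mk_snd X Y 0 b

lemma smooth_proj (x : Gt) : Smooth (Model (n + 1)) (Model n) A.proj x := A.contMDiff_proj x

lemma smooth_fib (t : ℝ) : Smooth ℝ (Model (n + 1)) A.fib t := A.contMDiff_fib t

lemma D_fib_zero : D ℝ (Model (n + 1)) A.fib 0 1 = A.central := A.mfderiv_fib

lemma Dproj_adj (x : Gt) (v : Model (n + 1)) :
    A.Dproj (adj x v) = adj (A.proj x) (A.Dproj v) := by
  rw [Dproj, adj, adj, ← D_comp_of_eq (A.smooth_proj 1) (smooth_conj _ _) (by simp) v,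
    ← D_comp_of_eq (smooth_conj _ _) (A.smooth_proj 1) (by simp) v]
  simp only [map_mul, map_inv]

lemma D_proj_mul_right (x : Gt) (v : Model (n + 1)) :
    D (Model (n + 1)) (Model n) A.proj x
        (D (Model (n + 1)) (Model (n + 1)) (fun h : Gt => h * x) 1 v)
      = D (Model n) (Model n) (fun h : G => h * A.proj x) 1 (A.Dproj v) := by
  rw [D_right_translate (A.smooth_proj x), Dproj,
    ← D_comp_of_eq (smooth_mul_right _ _) (A.smooth_proj 1) (by simp) v]
  simp only [map_mul]

/-- Up to sign, the `Z`-component of `Ad_x Y` for `Y ∈ 𝔤 ⊂ 𝔤 ⊕ ℝ Z`. -/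
def adCoord (Y : Model n) (x : Gt) : ℝ := -A.centralCoord (adj x (A.incl Y))

lemma smooth_adCoord (Y : Model n) (x : Gt) : Smooth (Model (n + 1)) ℝ (A.adCoord Y) x := by
  have h : ContDiff ℝ ∞ (fun v : Model (n + 1) => -A.centralCoord v) :=
    A.centralCoord.contDiff.neg
  exact Smooth.comp_of_eq (g := fun v : Model (n + 1) => -A.centralCoord v)
    (smooth_iff_contDiffAt.2 h.contDiffAt) (smooth_adj_apply x (A.incl Y)) rfl

/-- A central factor drops out of conjugation. This is why the cochain is constant along `T`. -/
lemma adj_mul_fib (x : Gt) (t : ℝ) (v : Model (n + 1)) : adj (x * A.fib t) v = adj x v := by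
  rw [adj, adj]
  congr 2
  ext h
  rw [mul_assoc x, A.central_fib t h]; group

lemma adCoord_mul_fib (Y : Model n) (x : Gt) (t : ℝ) :
    A.adCoord Y (x * A.fib t) = A.adCoord Y x := by
  rw [adCoord, adCoord, adj_mul_fib]

/-- Since `Ad_{hx} = Ad_h Ad_x`, the derivative at `h = 1` is the bracket of `X` with `Ad_x Y`. Its
central component is the value of the cocycle on the projections to `𝔤`: here the cocycle enters the
cochain equation. -/
lemma D_adCoord (X Y : Model n) (x : Gt) :
    D (Model (n + 1)) ℝ (A.adCoord Y) x
        (D (Model (n + 1)) (Model (n + 1)) (fun h : Gt => h * x) 1 (A.incl X))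
      = -F.form X (adj (A.proj x) Y) := by
  rw [D_right_translate (A.smooth_adCoord Y x)]
  have h : (fun h : Gt => A.adCoord Y (h * x))
      = fun h => (-A.centralCoord) (adj h (adj x (A.incl Y))) := by
    ext h; rw [adCoord, adj_mul]; rfl
  have hs : Smooth (Model (n + 1)) ℝ (-A.centralCoord : Model (n + 1) →L[ℝ] ℝ)
      (adj (1 : Gt) (adj x (A.incl Y))) :=
    smooth_iff_contDiffAt.2 (-A.centralCoord).contDiff.contDiffAt
  rw [h, D_comp_apply 1 hs (smooth_adj_apply _ _), D_adj_one, D_eq_fderiv,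
    ContinuousLinearMap.fderiv, _root_.neg_apply, centralCoord_bracket_incl,
    Dproj_adj, Dproj_ofPair]

/-- The field `ξ̃_Y + η̃_{Ad_g Y}` is vertical. -/
lemma xi_add_eta (Y : Model n) (x : Gt) :
    (A.xiT Y x + A.etaT (Ad (A.proj x) Y) x : Model (n + 1))
      = -(A.adCoord Y x • D (Model (n + 1)) (Model (n + 1)) (fun h : Gt => h * x) 1 A.central) := by
  change D (Model (n + 1)) (Model (n + 1)) (fun h : Gt => x * h) 1 (A.incl Y)
    + -(D (Model (n + 1)) (Model (n + 1)) (fun h : Gt => h * x) 1 (A.incl (adj (A.proj x) Y))) = _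
  -- The component of `Ad_x Y` in `𝔤` is `Ad` of the projected point applied to `Y`, exactly what
  -- the right-invariant term subtracts; only the multiple of `Z` survives.
  have h := A.eq_incl_add (adj x (A.incl Y))
  rw [Dproj_adj] at h
  have h0 : A.Dproj (A.incl Y) = Y := A.Dproj_ofPair Y 0
  rw [h0] at h
  rw [D_mul_left_eq, h, map_add, map_smul, adCoord]
  simp

end CentralExtension

/-! ### Local right inverses and local sections -/

/-- A submersion between vector spaces has a smooth local right inverse. -/
lemma exists_smooth_rightInverse {E E' : Type*} [NormedAddCommGroup E] [NormedSpace ℝ E]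
    [NormedAddCommGroup E'] [NormedSpace ℝ E'] [FiniteDimensional ℝ E'] {f : E → E'} {a : E}
    (hf : ∀ᶠ x in nhds a, ContDiffAt ℝ ∞ f x) (hs : Function.Surjective (fderiv ℝ f a)) :
    ∃ h : E' → E, h (f a) = a ∧ ∀ᶠ y in nhds (f a), ContDiffAt ℝ ∞ h y ∧ f (h y) = y := by
  have : CompleteSpace E' := FiniteDimensional.complete ℝ E'
  obtain ⟨L, hL⟩ := (fderiv ℝ f a).exists_rightInverse_of_surjective
    (LinearMap.range_eq_top.2 hs)
  -- On the affine slice through `a` in the directions of a linear right inverse `L`, the derivative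
  -- of `f` at `a` becomes the identity, so the inverse function theorem applies.
  set ℓ : E' → E := fun y => a + L y with hℓ
  have hℓs : ContDiff ℝ ∞ ℓ := contDiff_const.add L.contDiff
  have hℓ0 : ℓ 0 = a := by simp [hℓ]
  set k : E' → E' := fun y => f (ℓ y) with hk
  have hkc : ∀ᶠ y in nhds (0 : E'), ContDiffAt ℝ ∞ k y := by
    have h1 : Filter.Tendsto ℓ (nhds 0) (nhds a) := by
      have := hℓs.continuous.tendsto 0
      rwa [hℓ0] at this
    exact (h1.eventually hf).mono fun y hy => hy.comp y hℓs.contDiffAt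
  have hk0 : ContDiffAt ℝ ∞ k 0 := hkc.self_of_nhds
  have hd : HasFDerivAt k ((ContinuousLinearEquiv.refl ℝ E' : E' ≃L[ℝ] E') : E' →L[ℝ] E') 0 := by
    have h1 : HasFDerivAt ℓ L 0 := L.hasFDerivAt.const_add a
    have h2 : HasFDerivAt f (fderiv ℝ f a) (ℓ 0) := by
      rw [hℓ0]; exact (hf.self_of_nhds.differentiableAt (by simp)).hasFDerivAt
    have h3 := h2.comp 0 h1
    rw [hL] at h3
    exact h3
  set e := hk0.toOpenPartialHomeomorph k hd (by simp) with he
  have hek : ∀ y, e y = k y := fun y => rfl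
  have h0s : (0 : E') ∈ e.source := hk0.mem_toOpenPartialHomeomorph_source hd (by simp)
  -- Smoothness of the inverse is needed on a neighbourhood, not only at the centre; invertibility
  -- of the derivative is an open condition.
  have hinv : ∀ᶠ y in nhds (0 : E'), ∃ A : E' ≃L[ℝ] E', (A : E' →L[ℝ] E') = fderiv ℝ k y := by
    have hc : ContinuousAt (fderiv ℝ k) 0 := (hk0.fderiv_right (m := ∞) (by simp)).continuousAt
    have hn := ContinuousLinearEquiv.nhds (ContinuousLinearEquiv.refl ℝ E')
    rw [← hd.fderiv] at hn
    exact hc.eventually_mem hn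
  have hk0a : k 0 = f a := by simp [hk, hℓ0]
  have hsymm0 : e.symm (f a) = 0 := by rw [← hk0a, ← hek]; exact e.left_inv h0s
  have hta : f a ∈ e.target := by rw [← hk0a, ← hek]; exact e.map_source h0s
  have hts : Filter.Tendsto e.symm (nhds (f a)) (nhds 0) := by
    have := e.continuousAt_symm hta
    rwa [ContinuousAt, hsymm0] at this
  refine ⟨fun y => ℓ (e.symm y), by simp only [hsymm0, hℓ0], ?_⟩
  filter_upwards [hts.eventually hkc, hts.eventually hinv, e.open_target.mem_nhds hta]
    with y hy1 hy2 hy3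
  obtain ⟨A, hA⟩ := hy2
  refine ⟨hℓs.contDiffAt.comp y (e.contDiffAt_symm hy3 (f₀' := A) ?_ hy1), e.right_inv hy3⟩
  rw [hA]
  exact (hy1.differentiableAt (by simp)).hasFDerivAt

namespace CentralExtension

variable {n : ℕ} {G : Type*} [TopologicalSpace G] [ChartedSpace (Model n) G] [Group G]
  [LieGroup 𝓘(ℝ, Model n) ∞ G]
  {Gt : Type*} [TopologicalSpace Gt] [ChartedSpace (Model (n + 1)) Gt] [Group Gt]
  [LieGroup 𝓘(ℝ, Model (n + 1)) ∞ Gt]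
  {F : Cocycle n G} (A : CentralExtension Gt F)

lemma D_proj_surjective (x : Gt) :
    Function.Surjective (D (Model (n + 1)) (Model n) A.proj x) := fun w =>
  ⟨D (Model (n + 1)) (Model (n + 1)) (fun h : Gt => h * x) 1
      (A.ofPair (D (Model n) (Model n) (fun h : G => h * (A.proj x)⁻¹) (A.proj x) w) 0), by
    rw [D_proj_mul_right, Dproj_ofPair, D_mul_right_inv']⟩

/-- The projection is a submersion by `D_proj_surjective`, so in charts it has a smooth right
inverse near the image of any preimage of `g`. -/
lemma exists_section (g : G) : ∃ (V : Set G) (s : G → Gt), A.IsSection V s ∧ g ∈ V := by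
  obtain ⟨x, rfl⟩ := A.surjective_proj g
  set φ := chartAt (Model (n + 1)) x with hφ
  set c := chartAt (Model n) (A.proj x) with hc
  have hφa : φ ∈ atlas (Model (n + 1)) Gt := chart_mem_atlas _ _
  have hca : c ∈ atlas (Model n) G := chart_mem_atlas _ _
  have hxs : x ∈ φ.source := mem_chart_source _ _
  have hcs : A.proj x ∈ c.source := mem_chart_source _ _
  have hφx : φ.symm (φ x) = x := φ.left_inv hxs
  have hps : ∀ z ∈ φ.target, Smooth (Model (n + 1)) (Model n) (fun z => A.proj (φ.symm z)) z :=
    fun z hz => Smooth.comp_of_eq (A.smooth_proj _) (smooth_chart_symm hφa hz) rfl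
  have hdom : ∀ᶠ z in nhds (φ x), z ∈ φ.target ∧ A.proj (φ.symm z) ∈ c.source := by
    refine (φ.open_target.eventually_mem (φ.map_source hxs)).and
      ((hps _ (φ.map_source hxs)).continuousAt.eventually_mem (c.open_source.mem_nhds ?_))
    rwa [hφx]
  obtain ⟨h, h0, hev⟩ := exists_smooth_rightInverse
    (f := fun z => c (A.proj (φ.symm z))) (a := φ x)
    (hdom.mono fun z hz => smooth_iff_contDiffAt.1
      (Smooth.comp_of_eq (smooth_chart hca hz.2) (hps z hz.1) rfl)) (by
    intro w
    obtain ⟨v, hv⟩ := A.D_proj_surjective x w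
    refine ⟨v, ?_⟩
    rw [← D_eq_fderiv, D_comp_of_eq (y := A.proj x) (smooth_chart hca hcs)
      (hps _ (φ.map_source hxs)) (by rw [hφx]), D_comp_of_eq (y := x) (A.smooth_proj x)
      (smooth_chart_symm hφa (φ.map_source hxs)) hφx, D_chartAt_symm_self, hv, D_chartAt_self])
  simp only [hφx] at h0 hev
  have hcont : ContinuousAt h (c (A.proj x)) := hev.self_of_nhds.1.continuousAt
  have hdom' : ∀ᶠ y in nhds (c (A.proj x)), h y ∈ φ.target ∧ A.proj (φ.symm (h y)) ∈ c.source := by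
    rw [← h0] at hdom
    exact hcont.eventually hdom
  have hall := (c.continuousAt hcs).eventually (hev.and hdom')
  obtain ⟨V, hV, hVo, hxV⟩ := eventually_nhds_iff.1
    (hall.and (c.open_source.eventually_mem hcs))
  refine ⟨V, fun g => φ.symm (h (c g)), ⟨hVo, fun g hg => ?_, fun g hg => ?_⟩, hxV⟩
  · obtain ⟨⟨⟨h1, -⟩, h2, -⟩, h4⟩ := hV g hg
    exact ContMDiffAt.contMDiffWithinAt (Smooth.comp_of_eq (smooth_chart_symm hφa h2)
      (Smooth.comp_of_eq (smooth_iff_contDiffAt.2 h1) (smooth_chart hca h4) rfl) rfl)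
  · obtain ⟨⟨⟨-, h1⟩, -, h3⟩, h4⟩ := hV g hg
    exact c.injOn h3 h4 h1

variable {A} {V : Set G} {s : G → Gt} (hs : A.IsSection V s)
include hs

lemma IsSection.smooth {g : G} (hg : g ∈ V) : Smooth (Model n) (Model (n + 1)) s g :=
  (hs.contMDiffOn g hg).contMDiffAt (hs.isOpen.mem_nhds hg)

lemma IsSection.proj_mul_fib {g : G} (hg : g ∈ V) (t : ℝ) : A.proj (s g * A.fib t) = g := by
  rw [map_mul, A.proj_fib, mul_one, hs.proj_apply g hg]

lemma IsSection.fibreCoord_mul_fib {g : G} (hg : g ∈ V) (t : ℝ) :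
    A.fibreCoord s (s g * A.fib t) = t := by
  rw [fibreCoord, hs.proj_mul_fib hg, inv_mul_cancel_left]
  exact Function.leftInverse_invFun A.injective_fib t

omit hs in
variable (A) in
lemma D_mul_fib (x : Gt) (t r : ℝ) :
    D ℝ (Model (n + 1)) (fun t => x * A.fib t) t r
      = r • D (Model (n + 1)) (Model (n + 1)) (fun h : Gt => (x * A.fib t) * h) 1 A.central := by
  have h1 : (fun r : ℝ => x * A.fib r) = fun r => (x * A.fib t) * A.fib (r - t) := by
    ext r
    rw [mul_assoc, ← A.fib_add]
    congr 2; ring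
  have h2 : Smooth ℝ ℝ (fun r : ℝ => r - t) t :=
    smooth_iff_contDiffAt.2 (contDiffAt_id.sub contDiffAt_const)
  have h3 : D ℝ ℝ (fun r : ℝ => r - t) t r = r := by
    rw [D_eq_fderiv]; simp [fderiv_sub_const]
  rw [h1, D_comp_of_eq (g := fun h : Gt => (x * A.fib t) * h) (y := 1) (smooth_mul_left _ _)
    (Smooth.comp_of_eq (A.smooth_fib 0) h2 (sub_self t)) (by simp [A.fib_zero]),
    D_comp_of_eq (A.smooth_fib 0) h2 (sub_self t), h3, ← A.D_fib_zero, ← map_smul, ← map_smul]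
  simp

/-- Near a point over `V`, the projection is trivialized by the section. -/
lemma IsSection.exists_localCoord {g₀ : G} (hg₀ : g₀ ∈ V) (t₀ : ℝ) :
    ∃ τ : Gt → ℝ, Smooth (Model (n + 1)) ℝ τ (s g₀ * A.fib t₀) ∧
      ∀ᶠ x in nhds (s g₀ * A.fib t₀), A.proj x ∈ V ∧ x = s (A.proj x) * A.fib (τ x) := by
  set x₀ := s g₀ * A.fib t₀ with hx₀
  set φ := chartAt (Model (n + 1)) x₀ with hφ
  set c := chartAt (Model n) g₀ with hc
  have hφa : φ ∈ atlas (Model (n + 1)) Gt := chart_mem_atlas _ _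
  have hca : c ∈ atlas (Model n) G := chart_mem_atlas _ _
  have hxs : x₀ ∈ φ.source := mem_chart_source _ _
  have hcs : g₀ ∈ c.source := mem_chart_source _ _
  have hct : c g₀ ∈ c.target := c.map_source hcs
  have hcg : c.symm (c g₀) = g₀ := c.left_inv hcs
  set b : Model n × ℝ → Gt := fun z => s (c.symm z.1) * A.fib z.2 with hb
  set a : Model n × ℝ := (c g₀, t₀) with ha
  have hba : b a = x₀ := by simp only [hb, ha, hcg, hx₀]
  have hbs : ∀ z : Model n × ℝ, z.1 ∈ c.target → c.symm z.1 ∈ V →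
      Smooth (Model n × ℝ) (Model (n + 1)) b z := by
    intro z hz hzV
    refine ContMDiffAt.mul ?_ ?_
    · exact Smooth.comp_of_eq (y := c.symm z.1) (hs.smooth hzV) (Smooth.comp_of_eq (y := z.1)
        (smooth_chart_symm hca hz) contDiff_fst.contMDiff.contMDiffAt rfl) rfl
    · exact Smooth.comp_of_eq (y := z.2) (A.smooth_fib _) contDiff_snd.contMDiff.contMDiffAt rfl
  have hba' : Smooth (Model n × ℝ) (Model (n + 1)) b a :=
    hbs a hct (by simpa only [ha, hcg] using hg₀)
  have hdom : ∀ᶠ z in nhds a, (z.1 ∈ c.target ∧ c.symm z.1 ∈ V) ∧ b z ∈ φ.source := by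
    have h1 : ∀ᶠ y in nhds (c g₀), y ∈ c.target ∧ c.symm y ∈ V := by
      refine (c.open_target.eventually_mem hct).and ((c.continuousAt_symm hct).eventually_mem
        (hs.isOpen.mem_nhds ?_))
      rwa [hcg]
    refine (continuousAt_fst.eventually h1).and (hba'.continuousAt.eventually_mem
      (φ.open_source.mem_nhds ?_))
    rwa [hba]
  have hfs : ∀ z : Model n × ℝ, (z.1 ∈ c.target ∧ c.symm z.1 ∈ V) ∧ b z ∈ φ.source →
      Smooth (Model n × ℝ) (Model (n + 1)) (fun z => φ (b z)) z := fun z hz =>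
    Smooth.comp_of_eq (smooth_chart hφa hz.2) (hbs z hz.1.1 hz.1.2) rfl
  have hDf : ∀ v, fderiv ℝ (fun z => φ (b z)) a v
      = D (Model n × ℝ) (Model (n + 1)) b a v := by
    intro v
    rw [← D_eq_fderiv, D_comp_of_eq (smooth_chart hφa hxs) hba' hba, D_chartAt_self]
  -- Projecting a kernel vector `(u, r)` to `G` kills the `T`-direction and gives `u = 0`. What is
  -- left is a translate of `r Z`; undoing the translation and `Ad` gives `r = 0`.
  have hinj : Function.Injective (fderiv ℝ (fun z => φ (b z)) a) := by
    rw [injective_iff_map_eq_zero]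
    rintro ⟨u, r⟩ hur
    rw [hDf] at hur
    have h1 : D (Model n × ℝ) (Model n) (fun z => A.proj (b z)) a (u, r) = 0 := by
      rw [D_comp_apply a (A.smooth_proj _) hba', hur, map_zero]
    have h2 : (fun z => A.proj (b z)) =ᶠ[nhds a] fun z => c.symm z.1 := by
      filter_upwards [hdom] with z hz using hs.proj_mul_fib hz.1.2 _
    have hfst : Smooth (Model n × ℝ) (Model n) (fun z : Model n × ℝ => z.1) a :=
      contDiff_fst.contMDiff.contMDiffAt
    rw [D_congr h2, D_comp_of_eq (y := c g₀) (smooth_chart_symm hca hct) hfst rfl,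
      D_chartAt_symm_self, D_eq_fderiv, fderiv_fst] at h1
    have hu : u = 0 := h1
    subst hu
    have hin : Smooth ℝ (Model n × ℝ) (fun t : ℝ => (c g₀, t)) t₀ :=
      smooth_iff_contDiffAt.2 (contDiffAt_const.prodMk contDiffAt_id)
    have h3 := D_comp_of_eq (y := a) hba' hin rfl r
    have h4 : D ℝ (Model n × ℝ) (fun t : ℝ => (c g₀, t)) t₀ r = (0, r) := by
      rw [D_eq_fderiv, (hasFDerivAt_prodMk_right (𝕜 := ℝ) (c g₀) t₀).fderiv]; rfl
    rw [h4, hur] at h3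
    simp only [hb, hcg] at h3
    rw [D_mul_fib, ← map_smul, D_mul_left_eq] at h3
    have h5 := D_mul_right_inv (s g₀ * A.fib t₀) (adj (s g₀ * A.fib t₀) (r • A.central))
    rw [h3, map_zero] at h5
    have h6 := adj_mul (s g₀ * A.fib t₀)⁻¹ (s g₀ * A.fib t₀) (r • A.central)
    rw [← h5, map_zero, inv_mul_cancel, adj_one] at h6
    have h7 := congrArg A.centralCoord h6
    rw [map_smul, centralCoord_ofPair, map_zero, smul_eq_mul, mul_one] at h7
    rw [h7]; rfl
  have hsurj : Function.Surjective (fderiv ℝ (fun z => φ (b z)) a) := by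
    refine (LinearMap.injective_iff_surjective_of_finrank_eq_finrank
      (f := (fderiv ℝ (fun z => φ (b z)) a).toLinearMap) ?_).1 hinj
    -- Both sides have dimension `n + 1`, so injectivity gives surjectivity.
    simp
  obtain ⟨h, h0, hev⟩ := exists_smooth_rightInverse
    (hdom.mono fun z hz => smooth_iff_contDiffAt.1 (hfs z hz)) hsurj
  simp only [hba] at h0 hev
  have hcont : ContinuousAt h (φ x₀) := hev.self_of_nhds.1.continuousAt
  rw [← h0] at hdom
  have hall := (φ.continuousAt hxs).eventually (hev.and (hcont.eventually hdom))
  -- A right inverse `h` of `φ ∘ b` suffices: it already writes every nearby `x` as `b (h (φ x))`,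
  -- so `s(V)T` contains a neighbourhood of the point, even if `ker π` is larger than `T`.
  refine ⟨fun x => (h (φ x)).2, ?_, ?_⟩
  · refine Smooth.comp_of_eq (g := Prod.snd) (y := h (φ x₀)) contDiff_snd.contMDiff.contMDiffAt
      (Smooth.comp_of_eq (smooth_iff_contDiffAt.2 hev.self_of_nhds.1) (smooth_chart hφa hxs) rfl)
      rfl
  · filter_upwards [hall, φ.open_source.mem_nhds hxs] with x hx hxs'
    obtain ⟨⟨-, h1⟩, ⟨-, h3⟩, h4⟩ := hx
    have hbx : b (h (φ x)) = x := φ.injOn h4 hxs' h1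
    have hpx : A.proj x = c.symm (h (φ x)).1 := by
      conv_lhs => rw [← hbx]
      exact hs.proj_mul_fib h3 _
    rw [hpx]
    exact ⟨h3, hbx.symm⟩

end CentralExtension

/-! ### The fibre coordinate, the cochain and its equation -/

namespace CentralExtension

variable {n : ℕ} {G : Type*} [TopologicalSpace G] [ChartedSpace (Model n) G] [Group G]
  [LieGroup 𝓘(ℝ, Model n) ∞ G]
  {Gt : Type*} [TopologicalSpace Gt] [ChartedSpace (Model (n + 1)) Gt] [Group Gt]
  [LieGroup 𝓘(ℝ, Model (n + 1)) ∞ Gt]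
  {F : Cocycle n G} {A : CentralExtension Gt F} {V : Set G} {s : G → Gt}

/-- Off `s(V)T` the value of `Function.invFun` may be arbitrary, but near a point of `s(V)T` the
coordinate agrees with the smooth function of `exists_localCoord`. -/
lemma IsSection.smooth_fibreCoord (hs : A.IsSection V s) {g : G} (hg : g ∈ V) (t : ℝ) :
    Smooth (Model (n + 1)) ℝ (A.fibreCoord s) (s g * A.fib t) := by
  obtain ⟨τ, hτ, hev⟩ := hs.exists_localCoord hg t
  refine hτ.congr_of_eventuallyEq ?_
  filter_upwards [hev] with x hx
  conv_lhs => rw [hx.2]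
  exact hs.fibreCoord_mul_fib hx.1 _

lemma IsSection.smooth_U (hs : A.IsSection V s) {g : G} (hg : g ∈ V) (t : ℝ) :
    Smooth (Model (n + 1)) ℝ (A.U s) (s g * A.fib t) :=
  Smooth.comp_of_eq (g := fun r : ℝ => Real.exp (-r))
    (smooth_iff_contDiffAt.2 (Real.contDiff_exp.comp contDiff_neg).contDiffAt)
    (hs.smooth_fibreCoord hg t) rfl

/-- Multiplying by `exp(rZ)` on the left is, by centrality, the same as on the right, and shifts the
coordinate from `t` to `t + r`. -/
lemma IsSection.D_fibreCoord_central (hs : A.IsSection V s) {g : G} (hg : g ∈ V) (t : ℝ) :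
    D (Model (n + 1)) ℝ (A.fibreCoord s) (s g * A.fib t)
      (D (Model (n + 1)) (Model (n + 1)) (fun h : Gt => h * (s g * A.fib t)) 1 A.central) = 1 := by
  have hsm := hs.smooth_fibreCoord hg t
  rw [D_right_translate hsm, ← A.D_fib_zero, ← D_comp_of_eq (y := 1)
    (Smooth.comp_of_eq hsm (smooth_mul_right _ _) (one_mul _)) (A.smooth_fib 0) A.fib_zero]
  have h : (fun r : ℝ => A.fibreCoord s (A.fib r * (s g * A.fib t))) = fun r => t + r := by
    ext r
    rw [A.central_fib, mul_assoc, ← A.fib_add, hs.fibreCoord_mul_fib hg]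
  rw [h, D_eq_fderiv]
  simp

lemma IsSection.D_fibreCoord_vertical (hs : A.IsSection V s) (Y : Model n) {g : G} (hg : g ∈ V)
    (t : ℝ) :
    D (Model (n + 1)) ℝ (A.fibreCoord s) (s g * A.fib t)
      (A.xiT Y (s g * A.fib t) + A.etaT (Ad (A.proj (s g * A.fib t)) Y) (s g * A.fib t))
      = -A.adCoord Y (s g) := by
  refine (congrArg (D (Model (n + 1)) ℝ (A.fibreCoord s) (s g * A.fib t))
    (A.xi_add_eta Y (s g * A.fib t))).trans ?_
  rw [map_neg, map_smul, hs.D_fibreCoord_central hg, adCoord_mul_fib, smul_eq_mul, mul_one]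

lemma IsSection.D_U (hs : A.IsSection V s) {g : G} (hg : g ∈ V) (t : ℝ) (v : Model (n + 1)) :
    D (Model (n + 1)) ℝ (A.U s) (s g * A.fib t) v
      = -(A.U s (s g * A.fib t) * D (Model (n + 1)) ℝ (A.fibreCoord s) (s g * A.fib t) v) := by
  have he : HasDerivAt (fun r : ℝ => Real.exp (-r))
      (Real.exp (-A.fibreCoord s (s g * A.fib t)) * -1) (A.fibreCoord s (s g * A.fib t)) :=
    (hasDerivAt_neg _).exp
  have h := D_comp_apply (g := fun r : ℝ => Real.exp (-r)) (s g * A.fib t)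
    (smooth_iff_contDiffAt.2 (Real.contDiff_exp.comp contDiff_neg).contDiffAt)
    (hs.smooth_fibreCoord hg t) v
  rw [D_eq_fderiv, he.hasFDerivAt.fderiv] at h
  refine h.trans ?_
  simp [U]
  ring

/-- The logarithmic derivative of `U` is `-dg⁰`, and `dg⁰` of the vertical field is `-adCoord`; the
right-hand side no longer contains `t`. -/
lemma IsSection.cochainAt_eq (hs : A.IsSection V s) (Y : Model n) {g : G} (hg : g ∈ V) (t : ℝ) :
    A.cochainAt s Y (s g * A.fib t) = A.adCoord Y (s g) := by
  have h := hs.D_U hg t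
    (A.xiT Y (s g * A.fib t) + A.etaT (Ad (A.proj (s g * A.fib t)) Y) (s g * A.fib t))
  rw [hs.D_fibreCoord_vertical Y hg t] at h
  refine (congrArg (fun r => (A.U s (s g * A.fib t))⁻¹ * r) h).trans ?_
  have h0 : A.U s (s g * A.fib t) ≠ 0 := (Real.exp_pos _).ne'
  field_simp

lemma IsSection.cochain_eq (hs : A.IsSection V s) (Y : Model n) {g : G} (hg : g ∈ V) :
    A.cochain s Y g = A.adCoord Y (s g) := by
  have h := hs.cochainAt_eq Y hg 0
  rwa [A.fib_zero, mul_one] at h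

variable (A) in
lemma isLinearMap_adCoord (x : Gt) : IsLinearMap ℝ (fun Y : Model n => A.adCoord Y x) where
  map_add X Y := by
    have h := A.ofPair_add X Y 0 0
    rw [add_zero] at h
    simp only [adCoord, incl, h, map_add]; ring
  map_smul r X := by
    have h := A.ofPair_smul r X 0
    rw [mul_zero] at h
    simp only [adCoord, incl, h, map_smul, smul_eq_mul]; ring

/-- A function on `G` whose pullback is `adCoord Y` satisfies the cochain equation. -/
lemma cochain_equation (X Y : Model n) {f : G → ℝ} {x : Gt}
    (hf : Smooth (Model n) ℝ f (A.proj x))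
    (h : (fun y => f (A.proj y)) =ᶠ[nhds x] A.adCoord Y) :
    dirDeriv f (A.proj x) (eta X (A.proj x))
      + invariantForm F.form (A.proj x) (eta X (A.proj x)) (xi Y (A.proj x)) = 0 := by
  have h1 := A.D_adCoord X Y x
  rw [← D_congr h, D_comp_apply x hf (A.smooth_proj x), D_proj_mul_right, Dproj_ofPair] at h1
  have h2 : dirDeriv f (A.proj x) (eta X (A.proj x)) = F.form X (adj (A.proj x) Y) := by
    change D (Model n) ℝ f (A.proj x)
      (-(D (Model n) (Model n) (fun h : G => h * A.proj x) 1 X)) = _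
    rw [map_neg, h1, neg_neg]
  -- In right translation `ξ_Y` becomes `Ad_g Y` and `η_X` becomes `-X`, so the magnetic term is
  -- `-F(X, Ad_g Y)`, opposite to the derivative of `f`.
  have h3 : D (Model n) (Model n) (fun h : G => h * (A.proj x)⁻¹) (A.proj x)
      (D (Model n) (Model n) (fun h : G => A.proj x * h) 1 Y) = adj (A.proj x) Y := by
    rw [D_mul_left_eq, D_mul_right_inv]
  have h4 : D (Model n) (Model n) (fun h : G => h * (A.proj x)⁻¹) (A.proj x)
      (-(D (Model n) (Model n) (fun h : G => h * A.proj x) 1 X)) = -X := by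
    rw [map_neg, D_mul_right_inv]
  have h5 : invariantForm F.form (A.proj x) (eta X (A.proj x)) (xi Y (A.proj x))
      = F.form (-X : Model n) (adj (A.proj x) Y) := by
    rw [← h3, ← h4]; rfl
  rw [h2, h5]
  have h6 : F.form (-X : Model n) = -F.form X := map_neg F.form _
  rw [h6]
  exact add_neg_cancel _

lemma IsSection.smooth_cochain (hs : A.IsSection V s) (Y : Model n) {g : G} (hg : g ∈ V) :
    Smooth (Model n) ℝ (A.cochain s Y) g := by
  have h : Smooth (Model n) ℝ (fun g => A.adCoord Y (s g)) g :=
    Smooth.comp_of_eq (A.smooth_adCoord Y (s g)) (hs.smooth hg) rfl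
  refine h.congr_of_eventuallyEq ?_
  filter_upwards [hs.isOpen.mem_nhds hg] with g' hg' using hs.cochain_eq Y hg'

/-- Near `s g` every point is `s(π x)` times an element of `T`, which `adCoord` does not see. The
equation on `G` can thus be checked on the extension. -/
lemma IsSection.cochain_proj (hs : A.IsSection V s) (Y : Model n) {g : G} (hg : g ∈ V) :
    (fun x => A.cochain s Y (A.proj x)) =ᶠ[nhds (s g)] A.adCoord Y := by
  obtain ⟨τ, -, hev⟩ := hs.exists_localCoord hg 0
  rw [A.fib_zero, mul_one] at hev
  filter_upwards [hev] with x hx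
  rw [hs.cochain_eq Y hx.1]
  conv_rhs => rw [hx.2, adCoord_mul_fib]

lemma IsSection.cochain_equation (hs : A.IsSection V s) (X Y : Model n) {g : G} (hg : g ∈ V) :
    dirDeriv (A.cochain s Y) g (eta X g) + invariantForm F.form g (eta X g) (xi Y g) = 0 := by
  have hp := hs.proj_apply g hg
  have h := CentralExtension.cochain_equation (A := A) X Y (f := A.cochain s Y) (x := s g)
    (by rw [hp]; exact hs.smooth_cochain Y hg) (hs.cochain_proj Y hg)
  rwa [hp] at h

/-- This is `D_fibreCoord_vertical` with `Ad_g e_a` expanded in the basis; `dg⁰` of the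
right-invariant field is linear in its generator. -/
lemma IsSection.cochain_basis (hs : A.IsSection V s) (b : Module.Basis (Fin n) ℝ (LieAlg n G))
    (a : Fin n) {g : G} (hg : g ∈ V) (t : ℝ) :
    A.cochain s (b a) g =
      -dirDeriv (A.fibreCoord s) (s g * A.fib t) (A.xiT (b a) (s g * A.fib t))
      - ∑ k, b.repr (Ad g (b a)) k *
        dirDeriv (A.fibreCoord s) (s g * A.fib t) (A.etaT (b k) (s g * A.fib t)) := by
  have h := hs.D_fibreCoord_vertical (b a) hg t
  rw [hs.proj_mul_fib hg] at h
  set x := s g * A.fib t with hx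
  let η : LieAlg n G →ₗ[ℝ] ℝ :=
    { toFun := fun Y => D (Model (n + 1)) ℝ (A.fibreCoord s) x (A.etaT Y x)
      map_add' := fun Y Z => by
        change D (Model (n + 1)) ℝ (A.fibreCoord s) x
            (-(D (Model (n + 1)) (Model (n + 1)) (fun h : Gt => h * x) 1 (A.ofPair (Y + Z) 0)))
          = D (Model (n + 1)) ℝ (A.fibreCoord s) x
            (-(D (Model (n + 1)) (Model (n + 1)) (fun h : Gt => h * x) 1 (A.ofPair Y 0)))
          + D (Model (n + 1)) ℝ (A.fibreCoord s) x
            (-(D (Model (n + 1)) (Model (n + 1)) (fun h : Gt => h * x) 1 (A.ofPair Z 0)))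
        have h := A.ofPair_add Y Z 0 0
        rw [add_zero] at h
        refine (congrArg (fun w => D (Model (n + 1)) ℝ (A.fibreCoord s) x
            (-(D (Model (n + 1)) (Model (n + 1)) (fun h : Gt => h * x) 1 w))) h).trans ?_
        rw [map_add, neg_add, map_add]
      map_smul' := fun r Y => by
        change D (Model (n + 1)) ℝ (A.fibreCoord s) x
            (-(D (Model (n + 1)) (Model (n + 1)) (fun h : Gt => h * x) 1 (A.ofPair (r • Y) 0)))
          = r • D (Model (n + 1)) ℝ (A.fibreCoord s) x
            (-(D (Model (n + 1)) (Model (n + 1)) (fun h : Gt => h * x) 1 (A.ofPair Y 0)))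
        have h := A.ofPair_smul r Y 0
        rw [mul_zero] at h
        refine (congrArg (fun w => D (Model (n + 1)) ℝ (A.fibreCoord s) x
            (-(D (Model (n + 1)) (Model (n + 1)) (fun h : Gt => h * x) 1 w))) h).trans ?_
        rw [map_smul, ← smul_neg, map_smul] }
  have h2 : η (Ad g (b a)) = ∑ k, b.repr (Ad g (b a)) k * η (b k) := by
    conv_lhs => rw [← b.sum_repr (Ad g (b a))]
    rw [map_sum]
    simp only [map_smul, smul_eq_mul]
  have h3 : D (Model (n + 1)) ℝ (A.fibreCoord s) x (A.xiT (b a) x) + η (Ad g (b a))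
      = -A.adCoord (b a) (s g) := by
    rw [← h]
    exact (map_add (D (Model (n + 1)) ℝ (A.fibreCoord s) x) _ _).symm
  refine (hs.cochain_eq (b a) hg).trans ?_
  rw [h2] at h3
  change _ = -(D (Model (n + 1)) ℝ (A.fibreCoord s) x (A.xiT (b a) x))
    - ∑ k, b.repr (Ad g (b a)) k * η (b k)
  linarith

end CentralExtension

/-! ### Kinetic energy of a pulled-back metric -/

section MetricCalculus

variable {n : ℕ}

lemma sum_stdVec (u : Model n) : ∑ i, u i • stdVec i = u := by
  ext k
  simp [stdVec, Pi.single_apply]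

lemma sum_mul_apply_stdVec (u : Model n) (L : Model n →ₗ[ℝ] ℝ) :
    ∑ i, u i * L (stdVec i) = L u := by
  conv_rhs => rw [← sum_stdVec u, map_sum]
  simp

variable (q : Model n →ₗ[ℝ] Model n →ₗ[ℝ] ℝ) (θ : Model n → Model n →L[ℝ] Model n)

/-- The matrix of the pullback of the bilinear form `q` under `θ x`. -/
def pullbackMatrix (x : Model n) : Matrix (Fin n) (Fin n) ℝ :=
  Matrix.of fun i j => q (θ x (stdVec i)) (θ x (stdVec j))

/-- The kinetic energy of the metric `pullbackMatrix q θ`. -/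
def kinetic (x p : Model n) : ℝ :=
  (1 / 2 : ℝ) * ∑ i, ∑ j, ((pullbackMatrix q θ x)⁻¹) i j * p i * p j

/-- The velocity that corresponds to the momentum `p`. -/
def velocity (x p : Model n) : Model n :=
  WithLp.toLp 2 ((pullbackMatrix q θ x)⁻¹.mulVec p)

lemma velocity_apply (x p : Model n) (i : Fin n) :
    velocity q θ x p i = ∑ j, ((pullbackMatrix q θ x)⁻¹) i j * p j := rfl

lemma kinetic_eq (x p : Model n) : kinetic q θ x p = (1 / 2 : ℝ) * ∑ i, p i * velocity q θ x p i := by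
  simp only [kinetic, velocity_apply, Finset.mul_sum]
  exact Finset.sum_congr rfl fun i _ => Finset.sum_congr rfl fun j _ => by ring

variable {q θ} (hq : ∀ u v, q u v = q v u)
include hq

lemma pullbackMatrix_inv_symm (x : Model n) (i j : Fin n) :
    (pullbackMatrix q θ x)⁻¹ i j = (pullbackMatrix q θ x)⁻¹ j i := by
  have h : (pullbackMatrix q θ x).transpose = pullbackMatrix q θ x := by
    ext i j; exact hq _ _
  have h2 := Matrix.transpose_nonsing_inv (pullbackMatrix q θ x)
  rw [h] at h2
  exact (congrFun (congrFun h2 j) i)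

lemma partialP_kinetic (x p : Model n) (k : Fin n) :
    partialP (kinetic q θ) x p k = velocity q θ x p k := by
  have h : HasFDerivAt (fun r : Model n => kinetic q θ x r)
      ((1 / 2 : ℝ) • ∑ i, ∑ j, (((pullbackMatrix q θ x)⁻¹ i j * p i) • EuclideanSpace.proj j
        + p j • ((pullbackMatrix q θ x)⁻¹ i j •
          (EuclideanSpace.proj i : Model n →L[ℝ] ℝ)))) p := by
    refine HasFDerivAt.const_mul (HasFDerivAt.fun_sum fun i _ => HasFDerivAt.fun_sum fun j _ => ?_) _
    exact ((EuclideanSpace.proj i : Model n →L[ℝ] ℝ).hasFDerivAt.const_mul _).mul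
      (EuclideanSpace.proj j : Model n →L[ℝ] ℝ).hasFDerivAt
  rw [partialP, h.fderiv, velocity_apply]
  have h1 : ∀ i j, (((pullbackMatrix q θ x)⁻¹ i j * p i) • EuclideanSpace.proj j
        + p j • ((pullbackMatrix q θ x)⁻¹ i j •
          (EuclideanSpace.proj i : Model n →L[ℝ] ℝ)) : Model n →L[ℝ] ℝ) (stdVec k)
      = (if j = k then (pullbackMatrix q θ x)⁻¹ k i * p i else 0)
        + (if i = k then (pullbackMatrix q θ x)⁻¹ k j * p j else 0) := by
    intro i j
    simp only [stdVec, add_apply, smul_apply, PiLp.proj_apply,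
      PiLp.single_apply, smul_eq_mul]
    rw [pullbackMatrix_inv_symm hq x k i]
    split_ifs <;> subst_vars <;> ring
  rw [smul_apply]
  simp only [sum_apply, h1]
  simp only [Finset.sum_add_distrib, Finset.sum_ite_eq', Finset.mem_univ, if_true, smul_eq_mul]
  have h2 : ∑ i, ∑ j, (if i = k then (pullbackMatrix q θ x)⁻¹ k j * p j else 0)
      = ∑ j, (pullbackMatrix q θ x)⁻¹ k j * p j := by
    rw [Finset.sum_comm]
    simp
  rw [h2]; ring

variable (hn : ∀ u, (∀ v, q v u = 0) → u = 0)
include hn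

omit hq in
-- A null vector of the matrix would have an image under `θ x` orthogonal to the whole range of `θ
-- x`, hence to everything.
lemma isUnit_det_pullbackMatrix {x : Model n} (hθ : Function.Bijective (θ x)) :
    IsUnit (pullbackMatrix q θ x).det := by
  rw [isUnit_iff_ne_zero]
  intro h0
  obtain ⟨v, hv, hMv⟩ := Matrix.exists_mulVec_eq_zero_iff.2 h0
  apply hv
  have h1 : ∀ i, q (θ x (stdVec i)) (θ x (WithLp.toLp 2 v)) = 0 := by
    intro i
    have h2 := sum_mul_apply_stdVec (WithLp.toLp 2 v)
      ((q (θ x (stdVec i))).comp (θ x : Model n →ₗ[ℝ] Model n))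
    have h3 : ∑ j, q (θ x (stdVec i)) (θ x (stdVec j)) * v j = 0 := congrFun hMv i
    refine h2.symm.trans (Eq.trans ?_ h3)
    exact Finset.sum_congr rfl fun j _ => mul_comm _ _
  have h4 : θ x (WithLp.toLp 2 v) = 0 := by
    refine hn _ fun w => ?_
    obtain ⟨u, rfl⟩ := hθ.2 w
    have h5 := sum_mul_apply_stdVec u
      ((q.flip (θ x (WithLp.toLp 2 v))).comp (θ x : Model n →ₗ[ℝ] Model n))
    refine h5.symm.trans (Finset.sum_eq_zero fun i _ => ?_)
    exact mul_eq_zero_of_right _ (h1 i)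
  have h6 : WithLp.toLp 2 v = (0 : Model n) := hθ.1 (h4.trans (map_zero _).symm)
  exact congrArg WithLp.ofLp h6

/-- Raising the index of `p` and pairing with `u` returns `p(u)`; this replaces later computations
with the inverse matrix. -/
lemma pairing_velocity {x : Model n} (hθ : Function.Bijective (θ x)) (p u : Model n) :
    q (θ x (velocity q θ x p)) (θ x u) = ∑ i, p i * u i := by
  have h1 : ∀ i, q (θ x (stdVec i)) (θ x (velocity q θ x p)) = p i := by
    intro i
    have h2 := sum_mul_apply_stdVec (velocity q θ x p)
      ((q (θ x (stdVec i))).comp (θ x : Model n →ₗ[ℝ] Model n))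
    have h3 : (pullbackMatrix q θ x).mulVec ((pullbackMatrix q θ x)⁻¹.mulVec p) i = p i := by
      rw [Matrix.mulVec_mulVec, Matrix.mul_nonsing_inv _ (isUnit_det_pullbackMatrix hn hθ),
        Matrix.one_mulVec]
    refine h2.symm.trans (Eq.trans ?_ h3)
    exact Finset.sum_congr rfl fun j _ => mul_comm _ _
  have h4 := sum_mul_apply_stdVec u
    ((q (θ x (velocity q θ x p))).comp (θ x : Model n →ₗ[ℝ] Model n))
  refine h4.symm.trans (Finset.sum_congr rfl fun i _ => ?_)
  rw [mul_comm]
  congr 1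
  exact (hq _ _).trans (h1 i)

omit hq hn in
lemma differentiableAt_det {M : Model n → Matrix (Fin n) (Fin n) ℝ} {x : Model n}
    (hM : ∀ i j, DifferentiableAt ℝ (fun y => M y i j) x) :
    DifferentiableAt ℝ (fun y => (M y).det) x := by
  simp only [Matrix.det_apply]
  refine DifferentiableAt.fun_sum fun σ _ => DifferentiableAt.const_smul ?_ _
  exact (HasFDerivAt.finsetProd (g := fun i y => M y (σ i) i)
    fun i _ => (hM (σ i) i).hasFDerivAt).differentiableAt

omit hq in
-- By Cramer's rule the inverse matrix has entries polynomial in those of the matrix, divided by a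
-- nonzero determinant.
lemma differentiableAt_velocity {x : Model n} (hθ : Function.Bijective (θ x))
    (hd : DifferentiableAt ℝ θ x) (p : Model n) :
    DifferentiableAt ℝ (fun y => velocity q θ y p) x := by
  have hM : ∀ i j, DifferentiableAt ℝ (fun y => pullbackMatrix q θ y i j) x := by
    intro i j
    have h1 : ∀ i, DifferentiableAt ℝ (fun y => θ y (stdVec i)) x := fun i =>
      hd.clm_apply (differentiableAt_const _)
    exact ((q.toContinuousBilinearMap.differentiableAt.comp x (h1 i)).clm_apply (h1 j) :)
  have hdet := differentiableAt_det hM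
  have hdet0 : (pullbackMatrix q θ x).det ≠ 0 := (isUnit_det_pullbackMatrix hn hθ).ne_zero
  have hadj : ∀ i j, DifferentiableAt ℝ (fun y => (pullbackMatrix q θ y).adjugate i j) x := by
    intro i j
    simp only [Matrix.adjugate_apply]
    refine differentiableAt_det fun k l => ?_
    by_cases hk : k = j
    · subst hk; simp
    · simpa [Matrix.updateRow_ne hk] using hM k l
  rw [differentiableAt_euclidean]
  intro i
  simp only [velocity_apply]
  refine DifferentiableAt.fun_sum fun j _ => DifferentiableAt.mul_const ?_ _
  simp only [Matrix.inv_def, Ring.inverse_eq_inv', Matrix.smul_apply, smul_eq_mul]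
  exact (hdet.inv hdet0).mul (hadj i j)

/-- A Killing field of the metric preserves the kinetic energy. -/
lemma fderiv_kinetic {ξ : Model n → Model n} {x : Model n}
    (hθ : ∀ᶠ y in nhds x, Function.Bijective (θ y)) (hd : DifferentiableAt ℝ θ x)
    (hξ : ∀ u, fderiv ℝ θ x (ξ x) u = -θ x (fderiv ℝ ξ x u)) (p : Model n) :
    fderiv ℝ (fun y => kinetic q θ y p) x (ξ x)
      = ∑ i, p i * fderiv ℝ ξ x (velocity q θ x p) i := by
  have hθx := hθ.self_of_nhds
  have hv := (differentiableAt_velocity hn hθx hd p).hasFDerivAt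
  set v' := fderiv ℝ (fun y => velocity q θ y p) x with hv'
  let ℓ : Model n →L[ℝ] ℝ := ∑ i, p i • EuclideanSpace.proj i
  have hℓ : ∀ u : Model n, ℓ u = ∑ i, p i * u i := fun u => by
    simp [ℓ, sum_apply]
  -- Energy in Legendre form, `p(v) - ½ q(θv, θv)`. It is stationary in `v` at the velocity, so the
  -- unknown derivative of `v` cancels and only that of `θ`, given by `hξ`, contributes.
  have h1 : (fun y => kinetic q θ y p) =ᶠ[nhds x] fun y => ℓ (velocity q θ y p)
      - (1 / 2 : ℝ) * q.toContinuousBilinearMap (θ y (velocity q θ y p))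
        (θ y (velocity q θ y p)) := by
    filter_upwards [hθ] with y hy
    rw [kinetic_eq, hℓ, LinearMap.toContinuousBilinearMap_apply, pairing_velocity hq hn hy]
    ring
  have h2 := hd.hasFDerivAt.clm_apply hv
  have h3 := (q.toContinuousBilinearMap.hasFDerivAt.comp x h2).clm_apply h2
  have h4 := (ℓ.hasFDerivAt.comp x hv).sub (h3.const_mul (1 / 2 : ℝ))
  have h5 := congrArg (fun L => L (ξ x)) (h1.fderiv_eq.trans h4.fderiv)
  refine h5.trans ?_
  have h6 := pairing_velocity hq hn hθx p (v' (ξ x))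
  have h7 := pairing_velocity hq hn hθx p (fderiv ℝ ξ x (velocity q θ x p))
  have h8 := hq (θ x (velocity q θ x p)) (θ x (v' (ξ x)))
  have h9 := hq (θ x (velocity q θ x p)) (θ x (fderiv ℝ ξ x (velocity q θ x p)))
  rw [← h7]
  simp [hξ, hℓ, h6, ← h8, ← h9]
  ring

end MetricCalculus

/-! ### The corrected momentum and the Hamiltonian in a chart -/

section IntegralsOfMotion

variable {n : ℕ} {G : Type*} [TopologicalSpace G] [ChartedSpace (Model n) G] [Group G]

/-- A bilinear form on the Lie algebra, as a form on the model space. -/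
def modelForm (B : LinearMap.BilinForm ℝ (LieAlg n G)) : Model n →ₗ[ℝ] Model n →ₗ[ℝ] ℝ := B

lemma sum_pullbackMatrix (q : Model n →ₗ[ℝ] Model n →ₗ[ℝ] ℝ) (θ : Model n → Model n →L[ℝ] Model n)
    (x u v : Model n) :
    ∑ i, ∑ j, pullbackMatrix q θ x i j * u i * v j = q (θ x u) (θ x v) := by
  have h1 : ∀ i, ∑ j, pullbackMatrix q θ x i j * u i * v j
      = u i * q (θ x (stdVec i)) (θ x v) := by
    intro i
    have h := sum_mul_apply_stdVec v
      ((q (θ x (stdVec i))).comp (θ x : Model n →ₗ[ℝ] Model n))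
    refine Eq.trans ?_ (congrArg (u i * ·) h)
    simp only [Finset.mul_sum]
    refine Finset.sum_congr rfl fun j _ => ?_
    change q (θ x (stdVec i)) (θ x (stdVec j)) * u i * v j
      = u i * (v j * q (θ x (stdVec i)) (θ x (stdVec j)))
    ring
  simp only [h1]
  exact sum_mul_apply_stdVec u ((q.flip (θ x v)).comp (θ x : Model n →ₗ[ℝ] Model n))

variable [LieGroup 𝓘(ℝ, Model n) ∞ G]
  {c : OpenPartialHomeomorph G (Model n)} (hc : c ∈ atlas (Model n) G)
include hc

lemma components_eq (B : LinearMap.BilinForm ℝ (LieAlg n G)) {x : Model n} (hx : x ∈ c.target) :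
    components B c x = pullbackMatrix (modelForm B) (rightForm c) x := by
  ext i j
  have h : ∀ i, rightForm c x (stdVec i) = toIdentity (c.symm x) (coordVec c x i) := fun i =>
    rightForm_apply hc hx _
  simp only [pullbackMatrix, Matrix.of_apply, h]
  rfl

lemma hamiltonian_eq (Q : LinearMap.BilinForm ℝ (LieAlg n G)) {x : Model n} (hx : x ∈ c.target)
    (p : Model n) : hamiltonian Q c x p = kinetic (modelForm Q) (rightForm c) x p := by
  rw [hamiltonian, components_eq hc Q hx, kinetic]

lemma D_mul_right_rightForm {x : Model n} (hx : x ∈ c.target) (v : Model n) :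
    D (Model n) (Model n) (fun h : G => h * c.symm x) 1 (rightForm c x v)
      = D (Model n) (Model n) c.symm x v := by
  rw [rightForm_apply hc hx, D_mul_right_inv']

lemma rightForm_bijective {x : Model n} (hx : x ∈ c.target) :
    Function.Bijective (rightForm c x) := by
  have h : Function.Injective (rightForm c x) := by
    rw [injective_iff_map_eq_zero]
    intro v hv
    have h1 := D_mul_right_rightForm hc hx v
    rw [hv, map_zero] at h1
    rw [← D_chart_comp_symm hc hx v, ← h1, map_zero]
  exact ⟨h, (LinearMap.injective_iff_surjective
    (f := (rightForm c x : Model n →ₗ[ℝ] Model n))).1 h⟩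

lemma apply_xi (P : Cotangent n G) (hP : P.proj ∈ c.source) (Y : Model n) :
    (P.snd (xi (Y : LieAlg n G) P.proj) : ℝ)
      = ∑ i, momentum c P i * leftField c (c P.proj) Y i := by
  have hx := c.map_source hP
  have h1 := leftField_apply hc hx Y
  rw [c.left_inv hP] at h1
  have h2 : D (Model n) (Model n) c.symm (c P.proj) (leftField c (c P.proj) Y)
      = D (Model n) (Model n) (fun h : G => P.proj * h) 1 Y := by
    rw [h1, D_symm_comp_chart hc hP]
  have h3 := sum_mul_apply_stdVec (leftField c (c P.proj) Y)
    (((P.snd : Model n →L[ℝ] ℝ).comp (D (Model n) (Model n) c.symm (c P.proj)) :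
      Model n →L[ℝ] ℝ) : Model n →ₗ[ℝ] ℝ)
  refine (congrArg (P.snd : Model n →L[ℝ] ℝ) h2).symm.trans (h3.symm.trans ?_)
  exact Finset.sum_congr rfl fun i _ => mul_comm _ _

/-- The integral of motion in the chart `c`. -/
lemma localExpr_eq (Y : Model n) (f : G → ℝ) (e : ℝ) {x : Model n} (hx : x ∈ c.target)
    (p : Model n) :
    localExpr (fun P : Cotangent n G => P.snd (xi (Y : LieAlg n G) P.proj) + e * f P.proj) c x p
      = ∑ i, p i * leftField c x Y i + e * f (c.symm x) := by
  change (∑ i, p i • (EuclideanSpace.proj i : Model n →L[ℝ] ℝ))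
    (D (Model n) (Model n) c (c.symm x) (D (Model n) (Model n) (fun h : G => c.symm x * h) 1 Y))
    + e * f (c.symm x) = _
  rw [← leftField_apply hc hx]
  simp [sum_apply]

lemma differentiableAt_leftField {x : Model n} (hx : x ∈ c.target) (Y : Model n) :
    DifferentiableAt ℝ (fun y => leftField c y Y) x :=
  ((smooth_leftField hc hx).differentiableAt (by simp)).clm_apply (differentiableAt_const _)

/-- Invariance of the Hamiltonian under the flow of a left-invariant field. -/
lemma fderiv_kinetic_leftField {Q : LinearMap.BilinForm ℝ (LieAlg n G)} (hQ : Q.IsSymm)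
    (hQn : Q.Nondegenerate) (Y : Model n) {x : Model n} (hx : x ∈ c.target) (p : Model n) :
    fderiv ℝ (fun y => kinetic (modelForm Q) (rightForm c) y p) x (leftField c x Y)
      = ∑ i, p i * fderiv ℝ (fun y => leftField c y Y) x
        (velocity (modelForm Q) (rightForm c) x p) i :=
  fderiv_kinetic (ξ := fun y => leftField c y Y) (fun u v => hQ.eq u v) (fun u hu => hQn.2 u hu)
    ((c.open_target.eventually_mem hx).mono fun _ hy => rightForm_bijective hc hy)
    ((smooth_rightForm hc hx).differentiableAt (by simp))
    (fun u => fderiv_rightForm_leftField hc hx u Y) p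

variable {F : LinearMap.BilinForm ℝ (LieAlg n G)} (hF : ∀ X, F X X = 0) {f : G → ℝ} {Y : Model n}

include hF in
/-- The differential of `f` compensates the magnetic term. -/
lemma fderiv_cochain {x : Model n} (hx : x ∈ c.target) (hf : Smooth (Model n) ℝ f (c.symm x))
    (heq : ∀ X : LieAlg n G, dirDeriv f (c.symm x) (eta X (c.symm x))
      + invariantForm F (c.symm x) (eta X (c.symm x)) (xi (Y : LieAlg n G) (c.symm x)) = 0)
    (v : Model n) :
    fderiv ℝ (fun y => f (c.symm y)) x v
      = modelForm F (rightForm c x (leftField c x Y)) (rightForm c x v) := by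
  rw [← D_eq_fderiv, D_comp_apply x hf (smooth_chart_symm hc hx)]
  -- The generator `-rightForm c x v` is chosen so that its field `η` at this point is the tangent
  -- vector with coordinates `v`: right-invariant fields span every tangent space.
  have h1 : D (Model n) ℝ f (c.symm x)
      (-(D (Model n) (Model n) (fun h : G => h * c.symm x) 1 (-rightForm c x v)))
    + modelForm F (D (Model n) (Model n) (fun h : G => h * (c.symm x)⁻¹) (c.symm x)
        (-(D (Model n) (Model n) (fun h : G => h * c.symm x) 1 (-rightForm c x v))))
      (D (Model n) (Model n) (fun h : G => h * (c.symm x)⁻¹) (c.symm x)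
        (D (Model n) (Model n) (fun h : G => c.symm x * h) 1 Y)) = 0 :=
    heq (-rightForm c x v : Model n)
  simp only [map_neg, neg_neg] at h1
  rw [D_mul_right_rightForm hc hx, ← rightForm_apply hc hx, D_mul_left_eq,
    D_mul_right_inv] at h1
  rw [rightForm_leftField hc hx]
  have h2 : ∀ u w : Model n, modelForm F u w + modelForm F w u = 0 := by
    intro u w
    have h3 : modelForm F (u + w) (u + w) = 0 := hF _
    have h4 : modelForm F u u = 0 := hF _
    have h5 : modelForm F w w = 0 := hF _
    simp only [map_add, LinearMap.add_apply, h4, h5] at h3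
    linarith
  linarith [h2 (rightForm c x v) (adj (c.symm x) Y)]

include hF in
/-- The momentum map commutes with the Hamiltonian, in coordinates. -/
lemma coordinate_identity {Q : LinearMap.BilinForm ℝ (LieAlg n G)} (hQ : Q.IsSymm)
    (hQn : Q.Nondegenerate) (e : ℝ) {x : Model n} (hx : x ∈ c.target)
    (hf : Smooth (Model n) ℝ f (c.symm x))
    (heq : ∀ X : LieAlg n G, dirDeriv f (c.symm x) (eta X (c.symm x))
      + invariantForm F (c.symm x) (eta X (c.symm x)) (xi (Y : LieAlg n G) (c.symm x)) = 0)
    (p : Model n) :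
    ∑ i, leftField c x Y i * partialG (hamiltonian Q c) x p i
      - (∑ i, p i * fderiv ℝ (fun y => leftField c y Y) x
        (velocity (modelForm Q) (rightForm c) x p) i
        + e * fderiv ℝ (fun y => f (c.symm y)) x (velocity (modelForm Q) (rightForm c) x p))
      + e * ∑ i, ∑ j, components F c x i j * leftField c x Y i
        * velocity (modelForm Q) (rightForm c) x p j = 0 := by
  have hH : (fun y => hamiltonian Q c y p)
      =ᶠ[nhds x] fun y => kinetic (modelForm Q) (rightForm c) y p :=
    (c.open_target.eventually_mem hx).mono fun y hy => hamiltonian_eq hc Q hy p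
  simp only [partialG, hH.fderiv_eq]
  have h1 := sum_mul_apply_stdVec (leftField c x Y)
    (fderiv ℝ (fun y => kinetic (modelForm Q) (rightForm c) y p) x : Model n →ₗ[ℝ] ℝ)
  simp only [ContinuousLinearMap.coe_coe] at h1
  -- The Killing property cancels the terms without `e`; those with `e` are `-e F(ξ, v)` from the
  -- differential of `f` and `+e F(ξ, v)` from the magnetic force.
  rw [h1, fderiv_kinetic_leftField hc hQ hQn Y hx p, components_eq hc F hx, sum_pullbackMatrix,
    fderiv_cochain hc hF hx hf heq]
  ring

lemma partialP_hamiltonian {Q : LinearMap.BilinForm ℝ (LieAlg n G)} (hQ : Q.IsSymm)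
    {x : Model n} (hx : x ∈ c.target) (p : Model n) (i : Fin n) :
    partialP (hamiltonian Q c) x p i = velocity (modelForm Q) (rightForm c) x p i := by
  rw [← partialP_kinetic (q := modelForm Q) (fun u v => hQ.eq u v) x p i, partialP, partialP]
  congr 2
  ext r
  exact hamiltonian_eq hc Q hx r

include hF in
lemma poissonBracket_eq_zero {Q : LinearMap.BilinForm ℝ (LieAlg n G)} (hQ : Q.IsSymm)
    (hQn : Q.Nondegenerate) (e : ℝ) {x : Model n} (hx : x ∈ c.target)
    (hf : Smooth (Model n) ℝ f (c.symm x))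
    (heq : ∀ X : LieAlg n G, dirDeriv f (c.symm x) (eta X (c.symm x))
      + invariantForm F (c.symm x) (eta X (c.symm x)) (xi (Y : LieAlg n G) (c.symm x)) = 0)
    (p : Model n) :
    poissonBracket F e c (localExpr (fun P : Cotangent n G =>
      P.snd (xi (Y : LieAlg n G) P.proj) + e * f P.proj) c) (hamiltonian Q c) x p = 0 := by
  set φ := localExpr (fun P : Cotangent n G =>
      P.snd (xi (Y : LieAlg n G) P.proj) + e * f P.proj) c with hφ
  have hP : ∀ i, partialP φ x p i = leftField c x Y i := by
    intro i
    have h1 : (fun r => φ x r) = fun r : Model n => (∑ i, leftField c x Y i •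
        (EuclideanSpace.proj i : Model n →L[ℝ] ℝ)) r + e * f (c.symm x) := by
      ext r
      rw [hφ, localExpr_eq hc Y f e hx]
      simp [sum_apply, mul_comm]
    rw [partialP, h1, fderiv_add_const, ContinuousLinearMap.fderiv]
    simp [sum_apply, stdVec]
  have hG : ∀ u, fderiv ℝ (fun y => φ y p) x u
      = ∑ i, p i * fderiv ℝ (fun y => leftField c y Y) x u i
        + e * fderiv ℝ (fun y => f (c.symm y)) x u := by
    intro u
    let ℓ : Model n →L[ℝ] ℝ := ∑ i, p i • EuclideanSpace.proj i
    have hℓ : ∀ u : Model n, ℓ u = ∑ i, p i * u i := fun u => by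
      simp [ℓ, sum_apply]
    have h1 : (fun y => φ y p) =ᶠ[nhds x] fun y => ℓ (leftField c y Y) + e * f (c.symm y) := by
      filter_upwards [c.open_target.mem_nhds hx] with y hy
      rw [hφ, localExpr_eq hc Y f e hy, hℓ]
    have hfd : DifferentiableAt ℝ (fun y => f (c.symm y)) x :=
      (smooth_iff_contDiffAt.1 (Smooth.comp_of_eq hf (smooth_chart_symm hc hx) rfl)).differentiableAt
        (by simp)
    have h2 := (ℓ.hasFDerivAt.comp x (differentiableAt_leftField hc hx Y).hasFDerivAt).add
      (hfd.hasFDerivAt.const_mul e)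
    refine (congrArg (fun L => L u) (h1.fderiv_eq.trans h2.fderiv)).trans ?_
    rw [← hℓ]
    rfl
  have hK := coordinate_identity hc hF hQ hQn e hx hf heq p
  have h2 := sum_mul_apply_stdVec (velocity (modelForm Q) (rightForm c) x p)
    (fderiv ℝ (fun y => φ y p) x : Model n →ₗ[ℝ] ℝ)
  simp only [ContinuousLinearMap.coe_coe] at h2
  rw [hG] at h2
  rw [← h2] at hK
  simp only [poissonBracket, hP, partialP_hamiltonian hc hQ hx, Finset.sum_sub_distrib]
  refine Eq.trans ?_ hK
  congr 2
  exact Finset.sum_congr rfl fun i _ => mul_comm _ _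

end IntegralsOfMotion

/-! ### Smoothness and conservation along trajectories -/

section Conservation

variable {n : ℕ} {G : Type*} [TopologicalSpace G] [ChartedSpace (Model n) G] [Group G]
  [LieGroup 𝓘(ℝ, Model n) ∞ G]

/-- In the trivialization given by a chart `c`, the field at `g` reads `leftField c (c g) Y`, which
is already known to be smooth. -/
lemma contMDiff_xi (Y : LieAlg n G) :
    ContMDiff 𝓘(ℝ, Model n) (𝓘(ℝ, Model n).prod 𝓘(ℝ, Model n)) ∞
      (fun g : G => Bundle.TotalSpace.mk' (Model n) (E := TangentSpace 𝓘(ℝ, Model n)) g (xi Y g)) := by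
  have : IsManifold 𝓘(ℝ, Model n) 1 G := IsManifold.of_le (n := ∞) (by simp)
  intro g₀
  rw [Bundle.contMDiffAt_section]
  set c := chartAt (Model n) g₀ with hc
  have hca : c ∈ atlas (Model n) G := chart_mem_atlas _ _
  have hg₀ : g₀ ∈ c.source := mem_chart_source _ _
  have h1 : Smooth (Model n) (Model n) (fun g => leftField c (c g) (Y : Model n)) g₀ :=
    ContMDiffAt.clm_apply (Smooth.comp_of_eq
      (smooth_iff_contDiffAt.2 (smooth_leftField hca (c.map_source hg₀)))
      (smooth_chart hca hg₀) rfl) contMDiffAt_const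
  refine h1.congr_of_eventuallyEq ?_
  filter_upwards [c.open_source.mem_nhds hg₀] with g hg
  have h2 := leftField_apply hca (c.map_source hg) (Y : Model n)
  rw [c.left_inv hg] at h2
  rw [h2]
  have h3 := TangentBundle.continuousLinearMapAt_trivializationAt (I := 𝓘(ℝ, Model n)) hg
  have h4 : (trivializationAt (Model n) (TangentSpace 𝓘(ℝ, Model n)) g₀).continuousLinearMapAt ℝ g
      (xi Y g) = D (Model n) (Model n) c g (D (Model n) (Model n) (fun h : G => g * h) 1 Y) := by
    rw [h3]
    simp only [mfld_simps]
    rfl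
  rw [← h4, Bundle.Trivialization.continuousLinearMapAt_apply,
    Bundle.Trivialization.linearMapAt_apply, if_pos]
  simpa using hg

lemma contMDiffAt_momentumMap (Y : LieAlg n G) {f : G → ℝ} (e : ℝ) (P : Cotangent n G)
    (hf : Smooth (Model n) ℝ f P.proj) :
    ContMDiffAt (𝓘(ℝ, Model n).prod 𝓘(ℝ, Model n →L[ℝ] ℝ)) 𝓘(ℝ, ℝ) ∞
      (fun P : Cotangent n G => P.snd (xi Y P.proj) + e * f P.proj) P := by
  have hproj : ContMDiffAt (𝓘(ℝ, Model n).prod 𝓘(ℝ, Model n →L[ℝ] ℝ)) 𝓘(ℝ, Model n) ∞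
      (fun P : Cotangent n G => P.proj) P :=
    Bundle.contMDiff_proj (fun g : G => TangentSpace 𝓘(ℝ, Model n) g →L[ℝ] Bundle.Trivial G ℝ g) P
  refine ContMDiffAt.add ?_ (contMDiffAt_const.mul (ContMDiffAt.comp P hf hproj))
  have h1 := ContMDiffAt.clm_bundle_apply (n := ∞) (IB := 𝓘(ℝ, Model n)) (b := fun P : Cotangent n G => P.proj)
    (E₁ := TangentSpace 𝓘(ℝ, Model n)) (E₂ := Bundle.Trivial G ℝ)
    (ϕ := fun P : Cotangent n G => P.snd) (v := fun P => xi Y P.proj) (x := P)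
    (IM := 𝓘(ℝ, Model n).prod 𝓘(ℝ, Model n →L[ℝ] ℝ)) contMDiffAt_id
    (ContMDiffAt.comp P (contMDiff_xi Y P.proj) hproj)
  exact (Bundle.contMDiffAt_totalSpace.1 h1).2

variable {F : LinearMap.BilinForm ℝ (LieAlg n G)} (hF : ∀ X, F X X = 0)
  {Q : LinearMap.BilinForm ℝ (LieAlg n G)} (hQ : Q.IsSymm) (hQn : Q.Nondegenerate)
include hF hQ hQn

/-- By the chain rule in the chart at `γ t` and the equations of motion, the time derivative is
minus the left side of `coordinate_identity`. -/
lemma hasDerivAt_momentumMap {f : G → ℝ} {Y : Model n} (e : ℝ) {γ : ℝ → Cotangent n G} {J : Set ℝ}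
    (hJ : IsOpen J) (hγ : IsMagneticGeodesic Q F e γ J) {t : ℝ} (ht : t ∈ J)
    (hf : Smooth (Model n) ℝ f (γ t).proj)
    (heq : ∀ X : LieAlg n G, dirDeriv f (γ t).proj (eta X (γ t).proj)
      + invariantForm F (γ t).proj (eta X (γ t).proj) (xi (Y : LieAlg n G) (γ t).proj) = 0) :
    HasDerivAt (fun s => (γ s).snd (xi (Y : LieAlg n G) (γ s).proj) + e * f (γ s).proj) 0 t := by
  set c := chartAt (Model n) (γ t).proj with hc
  have hca : c ∈ atlas (Model n) G := chart_mem_atlas _ _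
  have hcs : (γ t).proj ∈ c.source := mem_chart_source _ _
  have hct := c.map_source hcs
  have hci : c.symm (c (γ t).proj) = (γ t).proj := c.left_inv hcs
  set p : Model n := WithLp.toLp 2 (momentum c (γ t)) with hp
  set x := c (γ t).proj with hx
  set v := velocity (modelForm Q) (rightForm c) x p with hv
  have hpos : HasDerivAt (fun s => c (γ s).proj) v t := by
    have h1 : HasDerivAt (fun s => ∑ i, (c (γ s).proj) i • (stdVec i : Model n))
        (∑ i, v i • stdVec i) t := by
      refine HasDerivAt.fun_sum fun i _ => HasDerivAt.smul_const ?_ _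
      have h2 := hγ.position c hca t ht hcs i
      rwa [partialP_hamiltonian hca hQ hct] at h2
    simpa only [sum_stdVec] using h1
  have hev : ∀ᶠ s in nhds t, (γ s).proj ∈ c.source :=
    (hγ.continuousOn.continuousAt (hJ.mem_nhds ht)).eventually_mem (c.open_source.mem_nhds hcs)
  have hloc : (fun s => (γ s).snd (xi (Y : LieAlg n G) (γ s).proj) + e * f (γ s).proj)
      =ᶠ[nhds t] fun s => (∑ i, momentum c (γ s) i * leftField c (c (γ s).proj) Y i)
        + e * f (c.symm (c (γ s).proj)) := by
    filter_upwards [hev] with s hs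
    rw [c.left_inv hs]
    congr 1
    exact apply_xi hca (γ s) hs Y
  have hξ : HasDerivAt (fun s => leftField c (c (γ s).proj) Y)
      (fderiv ℝ (fun y => leftField c y Y) x v) t :=
    (differentiableAt_leftField hca hct Y).hasFDerivAt.comp_hasDerivAt
      (f := fun s => c (γ s).proj) t hpos
  have hfd : DifferentiableAt ℝ (fun y => f (c.symm y)) x :=
    (smooth_iff_contDiffAt.1 (Smooth.comp_of_eq hf (smooth_chart_symm hca hct)
      hci)).differentiableAt (by simp)
  have hfc : HasDerivAt (fun s => f (c.symm (c (γ s).proj)))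
      (fderiv ℝ (fun y => f (c.symm y)) x v) t :=
    hfd.hasFDerivAt.comp_hasDerivAt (f := fun s => c (γ s).proj) t hpos
  have hmom := hγ.momentum c hca t ht hcs
  have hξi : ∀ i, HasDerivAt (fun s => leftField c (c (γ s).proj) Y i)
      (fderiv ℝ (fun y => leftField c y Y) x v i) t := fun i =>
    (EuclideanSpace.proj i : Model n →L[ℝ] ℝ).hasFDerivAt.comp_hasDerivAt t hξ
  have hsum := (HasDerivAt.fun_sum (u := Finset.univ) fun i _ => (hmom i).mul (hξi i)).add
    (hfc.const_mul e)
  refine (hsum.congr_deriv ?_).congr_of_eventuallyEq hloc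
  rw [← hci] at hf heq
  have hK := coordinate_identity hca hF hQ hQn e hct hf heq p
  have hPv : ∀ j, partialP (hamiltonian Q c) x p j = v j := partialP_hamiltonian hca hQ hct p
  simp only [← hx, ← hp, ← hv] at hK ⊢
  simp only [hPv]
  rw [← neg_eq_zero] at hK
  refine Eq.trans ?_ hK
  have h1 : ∑ i, leftField c x Y i * partialG (hamiltonian Q c) x p i
      + e * ∑ i, ∑ j, components F c x i j * leftField c x Y i * v j
      = -∑ i, (-partialG (hamiltonian Q c) x p i - e * ∑ j, components F c x i j * v j)
        * leftField c x Y i := by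
    rw [Finset.mul_sum, ← Finset.sum_add_distrib, ← Finset.sum_neg_distrib]
    refine Finset.sum_congr rfl fun i _ => ?_
    have h2 : ∑ j, components F c x i j * leftField c x Y i * v j
        = leftField c x Y i * ∑ j, components F c x i j * v j := by
      rw [Finset.mul_sum]
      exact Finset.sum_congr rfl fun j _ => by ring
    rw [h2]; ring
  rw [Finset.sum_add_distrib]
  have h3 : ∑ i, MagneticFlow.momentum c (γ t) i * fderiv ℝ (fun y => leftField c y Y) x v i
      = ∑ i, p i * fderiv ℝ (fun y => leftField c y Y) x v i := rfl
  rw [h3]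
  linarith

/-- A left momentum map, corrected by a solution of the cochain equation, is an integral of the
magnetic geodesic flow. -/
lemma isIntegralOfMotionOn {V : Set G} {f : G → ℝ} {Y : Model n} (e : ℝ)
    (hf : ∀ g ∈ V, Smooth (Model n) ℝ f g)
    (heq : ∀ X : LieAlg n G, ∀ g ∈ V, dirDeriv f g (eta X g)
      + invariantForm F g (eta X g) (xi (Y : LieAlg n G) g) = 0) :
    IsIntegralOfMotionOn Q F e V
      (fun P : Cotangent n G => P.snd (xi (Y : LieAlg n G) P.proj) + e * f P.proj) where
  smooth P hP := (contMDiffAt_momentumMap Y e P (hf _ hP)).contMDiffWithinAt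
  bracket_eq_zero c hc x hx hV p :=
    poissonBracket_eq_zero hc hF hQ hQn e hx (hf _ hV) (fun X => heq X _ hV) p
  constant γ J hJ hJc hγ hV t₁ h₁ t₂ h₂ := by
    have h : ∀ t ∈ J, HasDerivAt
        (fun s => (γ s).snd (xi (Y : LieAlg n G) (γ s).proj) + e * f (γ s).proj) 0 t := fun t ht =>
      hasDerivAt_momentumMap hF hQ hQn e hJ hγ ht (hf _ (hV t ht)) (fun X => heq X _ (hV t ht))
    exact hJ.is_const_of_deriv_eq_zero hJc
      (fun t ht => (h t ht).differentiableAt.differentiableWithinAt) (fun t ht => (h t ht).deriv)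
      h₁ h₂

end Conservation

/-! ### The global cochain -/

namespace CentralExtension

variable {n : ℕ} {G : Type*} [TopologicalSpace G] [ChartedSpace (Model n) G] [Group G]
  [LieGroup 𝓘(ℝ, Model n) ∞ G]
  {Gt : Type*} [TopologicalSpace Gt] [ChartedSpace (Model (n + 1)) Gt] [Group Gt]
  [LieGroup 𝓘(ℝ, Model (n + 1)) ∞ Gt]
  {F : Cocycle n G} (A : CentralExtension Gt F)

/-- When the kernel is `T`, the cochain extends to all of `G`. -/
lemma exists_global_cochain (hker : ∀ x : Gt, A.proj x = 1 → ∃ t : ℝ, A.fib t = x) :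
    ∃ f : LieAlg n G →ₗ[ℝ] C^∞⟮𝓘(ℝ, Model n), G; 𝓘(ℝ, ℝ), ℝ⟯,
      (∀ Y x, f Y (A.proj x) = A.adCoord Y x) := by
  have hinv : ∀ (Y : Model n) (x y : Gt), A.proj x = A.proj y → A.adCoord Y x = A.adCoord Y y := by
    intro Y x y hxy
    obtain ⟨t, ht⟩ := hker (y⁻¹ * x) (by rw [map_mul, map_inv, hxy, inv_mul_cancel])
    have h : x = y * A.fib t := by rw [ht, mul_inv_cancel_left]
    rw [h, adCoord_mul_fib]
  -- A set-theoretic section is enough: by `hinv` the value does not depend on the chosen preimage,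
  -- and smoothness is tested against smooth local sections.
  choose σ hσ using A.surjective_proj
  have hsm : ∀ Y : Model n, ContMDiff 𝓘(ℝ, Model n) 𝓘(ℝ, ℝ) ∞ (fun g => A.adCoord Y (σ g)) := by
    intro Y g
    obtain ⟨V, s, hs, hg⟩ := A.exists_section g
    refine (hs.smooth_cochain Y hg).congr_of_eventuallyEq ?_
    filter_upwards [hs.isOpen.mem_nhds hg] with g' hg'
    rw [hs.cochain_eq Y hg']
    exact hinv Y _ _ (by rw [hσ, hs.proj_apply g' hg'])
  refine ⟨{
    toFun := fun Y => ⟨fun g => A.adCoord Y (σ g), hsm Y⟩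
    map_add' := fun X Y => ContMDiffMap.ext fun g => (A.isLinearMap_adCoord (σ g)).map_add X Y
    map_smul' := fun r Y => ContMDiffMap.ext fun g => (A.isLinearMap_adCoord (σ g)).map_smul r Y },
    fun Y x => hinv Y _ _ (hσ _)⟩

end CentralExtension

end MagneticFlow

end

theorem mainTheorem5 {n : ℕ}
    {G : Type*} [TopologicalSpace G] [ChartedSpace (MagneticFlow.Model n) G] [Group G]
    [LieGroup 𝓘(ℝ, MagneticFlow.Model n) ∞ G]
    {Gt : Type*} [TopologicalSpace Gt] [ChartedSpace (MagneticFlow.Model (n + 1)) Gt] [Group Gt]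
    [LieGroup 𝓘(ℝ, MagneticFlow.Model (n + 1)) ∞ Gt]
    (F : MagneticFlow.Cocycle n G) (A : MagneticFlow.CentralExtension Gt F) :
    (∀ g : G, ∃ (V : Set G) (s : G → Gt), A.IsSection V s ∧ g ∈ V) ∧
    (∀ (V : Set G) (s : G → Gt), A.IsSection V s →
      (∀ g ∈ V, ∀ t : ℝ,
        ContMDiffAt 𝓘(ℝ, MagneticFlow.Model (n + 1)) 𝓘(ℝ, ℝ) ∞ (A.U s) (s g * A.fib t)) ∧
      (∀ Y, ∀ g ∈ V, ∀ t : ℝ, A.cochainAt s Y (s g * A.fib t) = A.cochain s Y g) ∧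
      (∀ g ∈ V, IsLinearMap ℝ (fun Y => A.cochain s Y g)) ∧
      (∀ Y, ContMDiffOn 𝓘(ℝ, MagneticFlow.Model n) 𝓘(ℝ, ℝ) ∞ (A.cochain s Y) V) ∧
      (∀ X Y, ∀ g ∈ V,
        MagneticFlow.dirDeriv (A.cochain s Y) g (MagneticFlow.eta X g)
          + MagneticFlow.invariantForm F.form g (MagneticFlow.eta X g) (MagneticFlow.xi Y g)
            = 0) ∧
      (∀ Q : LinearMap.BilinForm ℝ (MagneticFlow.LieAlg n G), Q.IsSymm → Q.Nondegenerate →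
        ∀ (e : ℝ) (X : MagneticFlow.LieAlg n G),
          MagneticFlow.IsIntegralOfMotionOn Q F.form e V
            (fun P => P.snd (MagneticFlow.xi X P.proj) + e * A.cochain s X P.proj)) ∧
      (∀ b : Module.Basis (Fin n) ℝ (MagneticFlow.LieAlg n G), ∀ a, ∀ g ∈ V, ∀ t : ℝ,
        A.cochain s (b a) g =
          -MagneticFlow.dirDeriv (A.fibreCoord s) (s g * A.fib t) (A.xiT (b a) (s g * A.fib t))
          - ∑ k, b.repr (MagneticFlow.Ad g (b a)) k *
            MagneticFlow.dirDeriv (A.fibreCoord s) (s g * A.fib t)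
              (A.etaT (b k) (s g * A.fib t)))) ∧
    ((∀ x : Gt, A.proj x = 1 → ∃ t : ℝ, A.fib t = x) →
      ∃ f : MagneticFlow.LieAlg n G →ₗ[ℝ]
          C^∞⟮𝓘(ℝ, MagneticFlow.Model n), G; 𝓘(ℝ, ℝ), ℝ⟯,
        (∀ (V : Set G) (s : G → Gt), A.IsSection V s →
          ∀ Y, ∀ g ∈ V, f Y g = A.cochain s Y g) ∧
        (∀ X Y g,
          MagneticFlow.dirDeriv (f Y) g (MagneticFlow.eta X g)
            + MagneticFlow.invariantForm F.form g (MagneticFlow.eta X g) (MagneticFlow.xi Y g)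
              = 0) ∧
        (∀ Q : LinearMap.BilinForm ℝ (MagneticFlow.LieAlg n G), Q.IsSymm → Q.Nondegenerate →
          ∀ (e : ℝ) (X : MagneticFlow.LieAlg n G),
            MagneticFlow.IsIntegralOfMotionOn Q F.form e Set.univ
              (fun P => P.snd (MagneticFlow.xi X P.proj) + e * f X P.proj))) := by
  refine ⟨fun g => A.exists_section g, fun V s hs => ⟨fun g hg t => hs.smooth_U hg t,
    fun Y g hg t => (hs.cochainAt_eq Y hg t).trans (hs.cochain_eq Y hg).symm, fun g hg => ?_,
    fun Y g hg => (hs.smooth_cochain Y hg).contMDiffWithinAt,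
    fun X Y g hg => hs.cochain_equation X Y hg,
    fun Q hQ hQn e X => MagneticFlow.isIntegralOfMotionOn F.form_self hQ hQn e
      (fun g hg => hs.smooth_cochain X hg) (fun X' g hg => hs.cochain_equation X' X hg),
    fun b a g hg t => hs.cochain_basis b a hg t⟩, fun hker => ?_⟩
  · have h : (fun Y => A.cochain s Y g) = fun Y => A.adCoord Y (s g) :=
      funext fun Y => hs.cochain_eq Y hg
    rw [h]
    exact A.isLinearMap_adCoord (s g)
  · obtain ⟨f, hf⟩ := A.exists_global_cochain hker
    have heq : ∀ X Y g, MagneticFlow.dirDeriv (f Y) g (MagneticFlow.eta X g)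
        + MagneticFlow.invariantForm F.form g (MagneticFlow.eta X g) (MagneticFlow.xi Y g) = 0 := by
      intro X Y g
      obtain ⟨x, rfl⟩ := A.surjective_proj g
      exact A.cochain_equation X Y ((f Y).contMDiff _) (Filter.Eventually.of_forall fun y => hf Y y)
    refine ⟨f, fun V s hs Y g hg => ?_, heq, fun Q hQ hQn e X =>
      MagneticFlow.isIntegralOfMotionOn F.form_self hQ hQn e (fun g _ => (f X).contMDiff g)
        (fun X' g _ => heq X' X g)⟩
    rw [hs.cochain_eq Y hg, ← hf Y (s g), hs.proj_apply g hg]
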